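/- For a function $f\colon \mathbb Z/N\mathbb Z\to\mathbb C$ and an integer $s\ge 1$, let $\|f\|_{U^s}\ge 0$ be the Gowers uniformity norm, defined by $\|f\|_{U^s}^{2^s}=\mathbb E_{n,h_1,\dots,h_s\in\mathbb Z/N\mathbb Z}\,\partial_{h_1}\cdots\partial_{h_s}f(n)$, where $\partial_h f(n)=f(n)\overline{f(n-h)}$. For $A\subseteq\mathbb Z/N\mathbb Z$ let $\Lambda_k(1_A)=\mathbb E_{n,d\in\mathbb Z/N\mathbb Z}\,1_A(n)1_A(n+d)\cdots 1_A(n+(k-1)d)$ be its $k$-AP density. For $k\ge 4$ and $0<\alpha<1$, let $\rho_k(\alpha)$ be the largest real number such that for every $\epsilon>0$ there exist $\eta>0$ and $N_0$ such that every $A\subseteq\mathbb Z/N\mathbb Z$ with $N\ge N_0$ and $\|1_A-\alpha\|_{U^{k-2}}\le\eta$ satisfies $\Lambda_k(1_A)\ge\rho_k(\alpha)-\epsilon$. Theorem (Odd $k$). For every odd integer $k\ge 5$ there is a constant $c_k>0$ such that, for all $0<\alpha<1/2$, the number $\rho_k(\alpha)$ is well defined (there is a largest such real number) and $$\rho_k(\alpha)<\alpha^{c_k\log(1/\alpha)};$$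 and moreover there is a $U^{k-2}$-uniform sequence of sets $A_N\subseteq\mathbb Z/N\mathbb Z$ ($N\ge 1$) of asymptotic density $\alpha$ and $k$-AP density at most $\alpha^{c_k\log(1/\alpha)}$, that is, $\|1_{A_N}-|A_N|/N\|_{U^{k-2}}\to 0$ and $|A_N|/N\to\alpha$ as $N\to\infty$, and $\Lambda_k(1_{A_N})\le\alpha^{c_k\log(1/\alpha)}$ for every $N\ge 1$. -/

import Mathlib

open Filter Topology
open scoped BigOperators

noncomputable section

/-- The multiplicative derivative `∂_h f (n) = f n * conj (f (n - h))`. -/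
def mulDeriv {G : Type*} [AddCommGroup G] (h : G) (f : G → ℂ) : G → ℂ :=
  fun n => f n * (starRingEnd ℂ) (f (n - h))

/-- The iterated multiplicative derivative `∂_{h 0} ∂_{h 1} ⋯ ∂_{h (s-1)} f`. -/
def iterMulDeriv {G : Type*} [AddCommGroup G] : (s : ℕ) → (Fin s → G) → (G → ℂ) → G → ℂ
  | 0, _, f => f
  | s + 1, h, f => mulDeriv (h 0) (iterMulDeriv s (fun i => h i.succ) f)

/-- The Gowers norm `‖f‖_{U^s}` on a finite abelian group, with
`‖f‖_{U^s} ^ (2 ^ s) = 𝔼_{n, h} ∂_{h 0} ⋯ ∂_{h (s-1)} f (n)`. For `s ≥ 1` the average on the right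
is a nonnegative real number, so that the absolute value taken here does not change it. -/
def gowersNorm {G : Type*} [AddCommGroup G] [Fintype G] (s : ℕ) (f : G → ℂ) : ℝ :=
  ‖𝔼 p : G × (Fin s → G), iterMulDeriv s p.2 f p.1‖ ^ ((1 : ℝ) / 2 ^ s)

/-- `Λ_k(f) = 𝔼_{n, d} f (n) f (n + d) ⋯ f (n + (k - 1) d)`. -/
def apForm {G : Type*} [AddCommGroup G] [Fintype G] (k : ℕ) (f : G → ℝ) : ℝ :=
  𝔼 p : G × G, ∏ i ∈ Finset.range k, f (p.1 + i • p.2)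

/-- The `k`-AP density `Λ_k(1_A)` of a set `A`. -/
def apDensity {G : Type*} [AddCommGroup G] [Fintype G] (k : ℕ) (A : Set G) : ℝ :=
  apForm k (A.indicator 1)

/-- `‖1_A - α‖_{U^s}`. -/
def gowersDist {G : Type*} [AddCommGroup G] [Fintype G] (s : ℕ) (A : Set G) (α : ℝ) : ℝ :=
  gowersNorm s (fun n => A.indicator (1 : G → ℂ) n - (α : ℂ))

/-- The real numbers `r` such that for every `ε > 0` there are `η > 0` and `N₀` for which every
`A ⊆ ℤ/Nℤ` with `N ≥ N₀` and `‖1_A - α‖_{U^{k-2}} ≤ η` satisfies `Λ_k(1_A) ≥ r - ε`. -/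
def apLowerBounds (k : ℕ) (α : ℝ) : Set ℝ :=
  {r | ∀ ε : ℝ, 0 < ε → ∃ η : ℝ, 0 < η ∧ ∃ N₀ : ℕ, ∀ (N : ℕ) [NeZero N], N₀ ≤ N →
    ∀ A : Set (ZMod N), gowersDist (k - 2) A α ≤ η → r - ε ≤ apDensity k A}

/-- The minimum `k`-AP density `ρ_k(α)` of a `U^{k-2}`-uniform set of density `α`: the largest
element of `apLowerBounds k α`. -/
def rho (k : ℕ) (α : ℝ) : ℝ := sSup (apLowerBounds k α)

/-- A sequence of sets `A_N ⊆ ℤ/Nℤ` is `U^s`-uniform if `‖1_{A_N} - |A_N|/N‖_{U^s} → 0`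
as `N → ∞`. -/
def IsGowersUniform (s : ℕ) (A : (N : ℕ) → Set (ZMod N)) : Prop :=
  ∀ ε : ℝ, 0 < ε → ∃ N₀ : ℕ, ∀ (N : ℕ) [NeZero N], N₀ ≤ N →
    gowersDist s (A N) (((A N).ncard : ℝ) / N) ≤ ε

end

/-! Put e = k − 1, which is even, and s = e − 1 = k − 2. The sets are `phaseSet`s: n is kept when
n^s/N mod 1 lies in an arc of length α whose starting point γ(j) depends only on which of M equal
intervals contains n.

Uniformity. A phase m·n^s + r·n with m ≠ 0 has degree s, so by Weyl differencing it is
asymptotically orthogonal to every test for the U^s norm (`norm_expect_polynomial_phase_le`).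
Fourier approximation on the circle transfers this to arcs for n^s and to intervals for n
(`isBoxSmall_phaseSet`), for any choice of γ.

Few progressions. The e-th difference of n^(e−1) along a progression of e + 1 = k terms is zero. If
all terms lie in the set, the e-th difference of the values of γ is therefore within 2^e·α of an
integer. Taking γ = (integer code)/T with T of size at most 1/α up to constants turns this into an
exact equation: the e-th difference of the code vanishes (`eq_zero_of_mem_circleArc`).

The code of n packs into one integer, for each scale l < D, coarse box indicators of q^l·n/N mod 1,
and above them the sum over l of the e-th powers of finer digits (`digitCode`). Vanishing of the
differences of the box indicators forces the dilated progressions not to wrap around. Then the e-th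
difference of the e-th powers is e!·Σ y_l^e up to rounding, where y_l is the rescaled step. As e is
even there is no cancellation, so every y_l is small; this is where k odd matters. Smallness at all
scales gives q^D·|d| ≤ N (`pow_mul_abs_valMinAbs_le`).

With q = 2^D the code has size 2^(O(D)), so α may be about 2^(−CD), while the admissible d have
density O(2^(−D²)). Since D is comparable to log(1/α), this is α^(c·log(1/α)). -/

/-! ### Box tests and Gowers norms -/

theorem expect_cons {G M : Type*} [Fintype G] [AddCommMonoid M] [Module ℚ≥0 M] (s : ℕ)
    (f : (Fin (s + 1) → G) → M) :
    𝔼 t, f t = 𝔼 a : G, 𝔼 t : Fin s → G, f (Fin.cons a t) := by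
  rw [← Finset.expect_product', Finset.univ_product_univ]
  exact (Fintype.expect_equiv (Fin.consEquiv (fun _ : Fin (s + 1) => G)) _ _ (fun _ => rfl)).symm

theorem norm_expect_le {ι : Type*} [Fintype ι] (f : ι → ℂ) : ‖𝔼 i, f i‖ ≤ 𝔼 i, ‖f i‖ := by
  rw [Fintype.expect_eq_sum_div_card, Fintype.expect_eq_sum_div_card, norm_div, Complex.norm_natCast]
  gcongr
  exact norm_sum_le _ _

theorem norm_expect_le_of_le {ι : Type*} [Fintype ι] [Nonempty ι] (f : ι → ℂ) {C : ℝ}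
    (h : ∀ i, ‖f i‖ ≤ C) : ‖𝔼 i, f i‖ ≤ C :=
  (norm_expect_le f).trans (Finset.expect_le Finset.univ_nonempty fun i _ => h i)

/-- Products of `1`-bounded functions, the `i`-th of which does not depend on the `i`-th
coordinate. -/
def IsBoxTest {G : Type*} : (s : ℕ) → ((Fin s → G) → ℂ) → Prop
  | 0, b => ∀ t, b t = 1
  | s + 1, b => ∃ (β : (Fin s → G) → ℂ) (b' : G → (Fin s → G) → ℂ),
      (∀ t, ‖β t‖ ≤ 1) ∧ (∀ a, IsBoxTest s (b' a)) ∧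
        ∀ a t, b (Fin.cons a t : Fin (s + 1) → G) = β t * b' a t

theorem IsBoxTest.norm_le {G : Type*} : ∀ {s : ℕ} {b : (Fin s → G) → ℂ}, IsBoxTest s b →
    ∀ t, ‖b t‖ ≤ 1
  | 0, b, h, t => by rw [h t]; simp
  | s + 1, b, ⟨β, b', hβ, hb', h⟩, t => by
    rw [← Fin.cons_self_tail t, h, norm_mul]
    exact mul_le_one₀ (hβ _) (norm_nonneg _) ((hb' _).norm_le _)

theorem IsBoxTest.one {G : Type*} : ∀ s : ℕ, IsBoxTest s (fun _ : Fin s → G => 1)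
  | 0 => fun _ => rfl
  | s + 1 => ⟨fun _ => 1, fun _ _ => 1, fun _ => by simp, fun _ => IsBoxTest.one s,
      fun _ _ => by simp⟩

theorem IsBoxTest.star {G : Type*} : ∀ {s : ℕ} {b : (Fin s → G) → ℂ}, IsBoxTest s b →
    IsBoxTest s (fun t => starRingEnd ℂ (b t))
  | 0, b, h => fun t => by simp [h t]
  | s + 1, b, ⟨β, b', hβ, hb', h⟩ =>
    ⟨fun t => starRingEnd ℂ (β t), fun a t => starRingEnd ℂ (b' a t), fun t => by simpa using hβ t,
      fun a => (hb' a).star, fun a t => by simp [h]⟩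

theorem IsBoxTest.mul {G : Type*} : ∀ {s : ℕ} {b c : (Fin s → G) → ℂ}, IsBoxTest s b →
    IsBoxTest s c → IsBoxTest s (fun t => b t * c t)
  | 0, b, c, h, h' => fun t => by simp [h t, h' t]
  | s + 1, b, c, ⟨β, b', hβ, hb', h⟩, ⟨γ, c', hγ, hc', h'⟩ =>
    ⟨fun t => β t * γ t, fun a t => b' a t * c' a t,
      fun t => by rw [norm_mul]; exact mul_le_one₀ (hβ _) (norm_nonneg _) (hγ _),
      fun a => (hb' a).mul (hc' a), fun a t => by simp only [h, h']; ring⟩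

section Gowers
variable {G : Type*} [AddCommGroup G]

theorem norm_iterMulDeriv_le {f : G → ℂ} (hf : ∀ x, ‖f x‖ ≤ 1) : ∀ (s : ℕ) (h : Fin s → G) (n : G),
    ‖iterMulDeriv s h f n‖ ≤ 1
  | 0, _, n => hf n
  | s + 1, h, n => by
    simp only [iterMulDeriv, mulDeriv, norm_mul, RCLike.norm_conj]
    exact mul_le_one₀ (norm_iterMulDeriv_le hf s _ _) (norm_nonneg _)
      (norm_iterMulDeriv_le hf s _ _)

/-- The iterated derivative of a real function is its value at the last vertex times a
function of the differences that tests box norms. -/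
theorem exists_isBoxTest_iterMulDeriv {f : G → ℂ} (hf : ∀ x, ‖f x‖ ≤ 1)
    (hr : ∀ x, starRingEnd ℂ (f x) = f x) : ∀ (s : ℕ) (n : G), ∃ b, IsBoxTest s b ∧
      ∀ h : Fin s → G, iterMulDeriv s h f n = f (n - ∑ i, h i) * b h
  | 0, n => ⟨fun _ => 1, IsBoxTest.one 0, fun h => by simp [iterMulDeriv]⟩
  | s + 1, n => by
    choose b hb hfb using exists_isBoxTest_iterMulDeriv hf hr s
    refine ⟨fun h => iterMulDeriv s (Fin.tail h) f n *
      starRingEnd ℂ (b (n - h 0) (Fin.tail h)), ⟨fun t => iterMulDeriv s t f n,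
        fun a t => starRingEnd ℂ (b (n - a) t), fun t => norm_iterMulDeriv_le hf s t n,
        fun a => (hb _).star, fun a t => by simp⟩, fun h => ?_⟩
    simp only [iterMulDeriv, mulDeriv]
    rw [hfb (n - h 0), map_mul, hr, Fin.sum_univ_succ, sub_sub]
    simp only [Fin.tail_def]
    ring

/-- With n fixed, all vertices of the cube other than n − Σ h_i omit some h_i and so form a box
test. It thus suffices to bound the correlation of f with box tests, uniformly in n. -/
theorem gowersNorm_le_of_isBoxTest [Fintype G] {f : G → ℂ} (hf : ∀ x, ‖f x‖ ≤ 1)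
    (hr : ∀ x, starRingEnd ℂ (f x) = f x) (s : ℕ) {ε : ℝ} (hε : 0 ≤ ε)
    (h : ∀ (n : G) (b : (Fin s → G) → ℂ), IsBoxTest s b →
      ‖𝔼 t : Fin s → G, f (n - ∑ i, t i) * b t‖ ≤ ε ^ 2 ^ s) :
    gowersNorm s f ≤ ε := by
  have key : ‖𝔼 p : G × (Fin s → G), iterMulDeriv s p.2 f p.1‖ ≤ ε ^ 2 ^ s := by
    rw [← Finset.univ_product_univ, Finset.expect_product]
    refine norm_expect_le_of_le _ fun n => ?_
    obtain ⟨b, hb, hfb⟩ := exists_isBoxTest_iterMulDeriv hf hr s n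
    simp only [hfb]
    exact h n b hb
  unfold gowersNorm
  calc _ ≤ (ε ^ 2 ^ s) ^ ((1 : ℝ) / 2 ^ s) :=
        Real.rpow_le_rpow (norm_nonneg _) key (by positivity)
    _ = ε := by
        rw [one_div, ← Nat.cast_ofNat (R := ℝ), ← Nat.cast_pow]
        exact Real.pow_rpow_inv_natCast hε (by positivity)

end Gowers

/-! ### Weyl's inequality modulo N, for arbitrary N -/

section Weyl
open Polynomial

/-- Kernel times image for multiplication by x, whose image is the subgroup generated by x. As N
need not be prime, the additive order replaces the condition x ≠ 0 throughout. -/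
theorem card_filter_mul_eq_zero {N : ℕ} [NeZero N] (x : ZMod N) :
    (Finset.univ.filter fun d : ZMod N => x * d = 0).card * addOrderOf x = N := by
  have h := AddSubgroup.card_mul_index (AddMonoidHom.mulLeft x).ker
  rw [AddSubgroup.index_ker, Nat.card_zmod] at h
  refine Eq.trans ?_ h
  congr 1
  · rw [Nat.card_eq_fintype_card, Fintype.card_subtype]
    simp only [AddMonoidHom.mem_ker, AddMonoidHom.coe_mulLeft]
  · rw [← Nat.card_zmultiples]
    congr 2
    ext y
    simp only [AddSubgroup.mem_zmultiples_iff, AddMonoidHom.mem_range, AddMonoidHom.coe_mulLeft]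
    constructor
    · rintro ⟨k, rfl⟩
      exact ⟨k, by rw [zsmul_eq_mul, mul_comm]⟩
    · rintro ⟨k, rfl⟩
      exact ⟨k.val, by simp [mul_comm]⟩

theorem addOrderOf_le_mul_addOrderOf {A : Type*} [AddCommGroup A] [Finite A] (x : A) {r : ℕ} (hr : 0 < r) :
    addOrderOf x ≤ r * addOrderOf (r • x) := by
  apply addOrderOf_le_of_nsmul_eq_zero
  · exact Nat.mul_pos hr (addOrderOf_pos _)
  · rw [mul_comm, mul_nsmul', addOrderOf_nsmul_eq_zero]

/-- Few multiples of an element of large order have small order. -/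
theorem expect_addOrderOf_mul_lt_le {N : ℕ} [NeZero N] (c : ZMod N) (M : ℕ) :
    (𝔼 d : ZMod N, if addOrderOf (c * d) < M then (1 : ℝ) else 0) ≤ M ^ 2 / addOrderOf c := by
  have hc : 0 < addOrderOf c := addOrderOf_pos c
  have hN : (0 : ℝ) < N := by exact_mod_cast NeZero.pos N
  rw [Fintype.expect_eq_sum_div_card, ZMod.card, Finset.sum_boole]
  -- Union bound over the possible orders r < M; each equation r·c·d = 0 has at most r·N / ord(c)
  -- solutions.
  have h1 : (Finset.univ.filter fun d : ZMod N => addOrderOf (c * d) < M) ⊆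
      (Finset.Ico 1 M).biUnion fun r => Finset.univ.filter fun d : ZMod N => (r • c) * d = 0 := by
    intro d hd
    simp only [Finset.mem_filter, Finset.mem_univ, true_and, Finset.mem_biUnion,
      Finset.mem_Ico] at hd ⊢
    exact ⟨addOrderOf (c * d), ⟨addOrderOf_pos _, hd⟩, by
      rw [smul_mul_assoc, addOrderOf_nsmul_eq_zero]⟩
  have h2 : ((Finset.univ.filter fun d : ZMod N => addOrderOf (c * d) < M).card : ℝ) ≤
      ∑ r ∈ Finset.Ico 1 M, (M : ℝ) * N / addOrderOf c := by
    calc ((Finset.univ.filter fun d : ZMod N => addOrderOf (c * d) < M).card : ℝ)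
        ≤ ∑ r ∈ Finset.Ico 1 M, ((Finset.univ.filter fun d : ZMod N => (r • c) * d = 0).card : ℝ) := by
          exact_mod_cast (Finset.card_le_card h1).trans Finset.card_biUnion_le
      _ ≤ _ := by
          refine Finset.sum_le_sum fun r hr => ?_
          rw [Finset.mem_Ico] at hr
          rw [le_div_iff₀ (by exact_mod_cast hc)]
          have h3 := card_filter_mul_eq_zero (r • c)
          have h4 := addOrderOf_le_mul_addOrderOf c (r := r) (by omega)
          have : (Finset.univ.filter fun d : ZMod N => (r • c) * d = 0).card * addOrderOf c ≤
              M * N := by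
            calc _ ≤ (Finset.univ.filter fun d : ZMod N => (r • c) * d = 0).card *
                  (r * addOrderOf (r • c)) := Nat.mul_le_mul_left _ h4
              _ = r * ((Finset.univ.filter fun d : ZMod N => (r • c) * d = 0).card * addOrderOf (r • c)) := by ring
              _ = r * N := by rw [h3]
              _ ≤ M * N := Nat.mul_le_mul_right _ hr.2.le
          exact_mod_cast this
  rw [div_le_iff₀ hN]
  refine h2.trans ?_
  rw [Finset.sum_const, Nat.card_Ico, nsmul_eq_mul, div_mul_eq_mul_div, mul_div_assoc']
  rw [sq, mul_assoc]
  gcongr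
  simp

/-- One Weyl differencing step: the top coefficients of the translates cancel, and the Taylor
expansion gives the next one. -/
theorem natDegree_comp_sub_comp_le {R : Type*} [CommRing R] {p : R[X]} {m : ℕ} (hp : p.natDegree ≤ m + 1)
    (a a' : R) : (p.comp (X - C a) - p.comp (X - C a')).natDegree ≤ m ∧
      (p.comp (X - C a) - p.comp (X - C a')).coeff m = (m + 1) * p.coeff (m + 1) * (a' - a) := by
  have h : ∀ a : R, (p.comp (X - C a)) = taylor (-a) p := fun a => by
    rw [taylor_apply, map_neg, sub_eq_add_neg]
  rw [h, h]
  have hc : ∀ a : R, (taylor a p).coeff (m + 1) = p.coeff (m + 1) := fun a => by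
    rw [taylor_coeff, eval_eq_sum_range' (n := 1)]
    · simp [hasseDeriv_coeff]
    · refine Nat.lt_one_iff.2 (Nat.le_zero.1 ((natDegree_hasseDeriv_le p (m + 1)).trans ?_))
      omega
  have hc' : ∀ a : R, (taylor a p).coeff m = p.coeff m + (m + 1) * p.coeff (m + 1) * a := fun a => by
    rw [taylor_coeff, eval_eq_sum_range' (n := 2)]
    · simp [Finset.sum_range_succ, hasseDeriv_coeff, Nat.choose_succ_self_right, add_comm 1 m]
    · refine Nat.lt_succ_of_le ((natDegree_hasseDeriv_le p m).trans ?_)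
      omega
  refine ⟨?_, by rw [coeff_sub, hc', hc']; ring⟩
  rw [natDegree_le_iff_coeff_eq_zero]
  intro j hj
  rcases (Nat.succ_le_of_lt hj).eq_or_lt with rfl | hj'
  · rw [coeff_sub, hc, hc, sub_self]
  · rw [coeff_sub, coeff_eq_zero_of_natDegree_lt, coeff_eq_zero_of_natDegree_lt, sub_zero] <;>
    · rw [natDegree_taylor]; omega

theorem expect_stdAddChar_linear {N : ℕ} [NeZero N] {c : ZMod N} (hc : c ≠ 0) :
    𝔼 a : ZMod N, ZMod.stdAddChar (c * a) = 0 := by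
  rw [Fintype.expect_eq_sum_div_card]
  have h := AddChar.sum_mulShift c (ZMod.isPrimitive_stdAddChar N)
  simp_rw [mul_comm c]
  rw [h, if_neg hc]
  simp

/-- Cauchy–Schwarz in t removes the factor β, which does not see the variable a, at the price of
doubling a. -/
theorem norm_sq_expect_mul_le {ι κ : Type*} [Fintype ι] [Fintype κ] [Nonempty κ] [Nonempty ι]
    (β : κ → ℂ) (hβ : ∀ t, ‖β t‖ ≤ 1) (u : ι → κ → ℂ) :
    ‖𝔼 a, 𝔼 t, β t * u a t‖ ^ 2 ≤ 𝔼 a, 𝔼 a', ‖𝔼 t, u a t * starRingEnd ℂ (u a' t)‖ := by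
  have h1 : 𝔼 a, 𝔼 t, β t * u a t = 𝔼 t, β t * 𝔼 a, u a t := by
    rw [Finset.expect_comm]
    simp_rw [Finset.mul_expect]
  have h2 : ‖𝔼 t, β t * 𝔼 a, u a t‖ ^ 2 ≤ 𝔼 t, ‖𝔼 a, u a t‖ ^ 2 := by
    have : ‖𝔼 t, β t * 𝔼 a, u a t‖ ≤ 𝔼 t, ‖𝔼 a, u a t‖ := by
      refine (norm_expect_le _).trans (Finset.expect_le_expect fun t _ => ?_)
      rw [norm_mul]
      exact mul_le_of_le_one_left (norm_nonneg _) (hβ t)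
    refine (pow_le_pow_left₀ (norm_nonneg _) this 2).trans ?_
    rw [Fintype.expect_eq_sum_div_card, Fintype.expect_eq_sum_div_card, div_pow,
      div_le_div_iff₀ (by positivity) (by positivity)]
    have := sq_sum_le_card_mul_sum_sq (s := (Finset.univ : Finset κ)) (f := fun t => ‖𝔼 a, u a t‖)
    rw [Finset.card_univ] at this
    nlinarith [Nat.cast_nonneg (α := ℝ) (Fintype.card κ)]
  have h3 : ((𝔼 t, ‖𝔼 a, u a t‖ ^ 2 : ℝ) : ℂ) =
      𝔼 a, 𝔼 a', 𝔼 t, u a t * starRingEnd ℂ (u a' t) := by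
    rw [Complex.ofReal_expect]
    have : ∀ t, ((‖𝔼 a, u a t‖ ^ 2 : ℝ) : ℂ) = 𝔼 a, 𝔼 a', u a t * starRingEnd ℂ (u a' t) := by
      intro t
      rw [Complex.ofReal_pow, ← Complex.mul_conj', Finset.expect_mul]
      refine Finset.expect_congr rfl fun a _ => ?_
      rw [← Finset.mul_expect]
      congr 1
      simp [Fintype.expect_eq_sum_div_card]
    simp_rw [this]
    rw [Finset.expect_comm]
    refine Finset.expect_congr rfl fun a _ => ?_
    rw [Finset.expect_comm]
  rw [h1]
  refine h2.trans ?_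
  rw [← Real.norm_of_nonneg (r := 𝔼 t, ‖𝔼 a, u a t‖ ^ 2)
    (Finset.expect_nonneg fun _ _ => by positivity), ← Complex.norm_real, h3]
  exact (norm_expect_le _).trans (Finset.expect_le_expect fun a _ => norm_expect_le _)

/-- Weyl's inequality against box tests: a polynomial phase of degree `m + 1` whose leading
coefficient has large order does not correlate with box tests. -/
theorem norm_expect_polynomial_phase_le (m : ℕ) : ∀ ε : ℝ, 0 < ε → ∃ M : ℕ, ∀ (N : ℕ) [NeZero N]
    (p : (ZMod N)[X]), p.natDegree ≤ m + 1 →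
      M ≤ addOrderOf (((m + 1).factorial : ZMod N) * p.coeff (m + 1)) →
      ∀ (n : ZMod N) (b : (Fin (m + 1) → ZMod N) → ℂ), IsBoxTest (m + 1) b →
        ‖𝔼 t : Fin (m + 1) → ZMod N, ZMod.stdAddChar (p.eval (n - ∑ i, t i)) * b t‖ ≤ ε := by
  induction m with
  | zero =>
    intro ε hε
    refine ⟨2, fun N _ p hp hM n b hb => ?_⟩
    obtain ⟨β, b', -, hb', hbb⟩ := hb
    have hc : p.coeff 1 ≠ 0 := by
      intro h0
      simp [h0] at hM
    rw [expect_cons]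
    have : ∀ a : ZMod N, 𝔼 t : Fin 0 → ZMod N, ZMod.stdAddChar (p.eval (n - ∑ i,
        (Fin.cons a t : Fin 1 → ZMod N) i)) * b (Fin.cons a t) =
        β 0 * ZMod.stdAddChar (p.eval (n - a)) := by
      intro a
      rw [Fintype.expect_eq_sum_div_card]
      rw [Finset.univ_unique, Finset.sum_singleton, hbb, hb' a, Fin.sum_cons,
        show ∀ t, β t = β 0 from fun t => congrArg β (Subsingleton.elim _ _)]
      simp [mul_comm]
    simp_rw [this]
    rw [← Finset.mul_expect]
    have h2 : 𝔼 a : ZMod N, ZMod.stdAddChar (p.eval (n - a)) = 0 := by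
      have h3 : ∀ a : ZMod N, ZMod.stdAddChar (p.eval (n - a)) =
          ZMod.stdAddChar (p.coeff 0 + p.coeff 1 * n) * ZMod.stdAddChar (-p.coeff 1 * a) := by
        intro a
        rw [← AddChar.map_add_eq_mul, eval_eq_sum_range' (n := 2) (by omega)]
        congr 1
        simp [Finset.sum_range_succ]
        ring
      simp_rw [h3]
      rw [← Finset.mul_expect, expect_stdAddChar_linear (neg_ne_zero.2 hc), mul_zero]
    rw [h2, mul_zero, norm_zero]
    exact hε.le
  | succ m ih =>
    intro ε hε
    obtain ⟨M', hM'⟩ := ih (ε ^ 2 / 2) (by positivity)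
    -- The pairs (a, a') for which c(a' − a) has order below M' have proportion at most M'²/ord(c) ≤
    -- ε²/2. They are bounded trivially, the others by the induction hypothesis.
    obtain ⟨M, hMpos⟩ := exists_nat_gt ((M' : ℝ) ^ 2 / (ε ^ 2 / 2))
    refine ⟨M + 1, fun N _ p hp hM n b hb => ?_⟩
    obtain ⟨β, b', hβ, hb', hbb⟩ := hb
    set c : ZMod N := ((m + 1 + 1).factorial : ZMod N) * p.coeff (m + 1 + 1) with hc
    refine abs_le_of_sq_le_sq' ?_ hε.le |>.2
    rw [expect_cons]
    have h1 : ∀ (a : ZMod N) (t : Fin (m + 1) → ZMod N), ZMod.stdAddChar (p.eval (n - ∑ i,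
        (Fin.cons a t : Fin (m + 1 + 1) → ZMod N) i)) * b (Fin.cons a t) =
        β t * (ZMod.stdAddChar ((p.comp (X - C a)).eval (n - ∑ i, t i)) * b' a t) := by
      intro a t
      rw [hbb, Fin.sum_cons, eval_comp, eval_sub, eval_X, eval_C, ← sub_sub, sub_right_comm]
      ring
    simp_rw [h1]
    refine (norm_sq_expect_mul_le β hβ _).trans ?_
    have h2 : ∀ a a' : ZMod N, ‖𝔼 t : Fin (m + 1) → ZMod N,
        ZMod.stdAddChar ((p.comp (X - C a)).eval (n - ∑ i, t i)) * b' a t *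
        starRingEnd ℂ (ZMod.stdAddChar ((p.comp (X - C a')).eval (n - ∑ i, t i)) * b' a' t)‖ ≤
        (if addOrderOf (c * (a' - a)) < M' then (1 : ℝ) else 0) + ε ^ 2 / 2 := by
      intro a a'
      have h3 : ∀ t : Fin (m + 1) → ZMod N,
        ZMod.stdAddChar ((p.comp (X - C a)).eval (n - ∑ i, t i)) * b' a t *
        starRingEnd ℂ (ZMod.stdAddChar ((p.comp (X - C a')).eval (n - ∑ i, t i)) * b' a' t) =
        ZMod.stdAddChar ((p.comp (X - C a) - p.comp (X - C a')).eval (n - ∑ i, t i)) *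
          (b' a t * starRingEnd ℂ (b' a' t)) := by
        intro t
        rw [eval_sub, AddChar.map_sub_eq_div, map_mul, ← AddChar.map_neg_eq_conj,
          AddChar.map_neg_eq_inv, div_eq_mul_inv]
        ring
      simp_rw [h3]
      have hb2 : IsBoxTest (m + 1) fun t => b' a t * starRingEnd ℂ (b' a' t) :=
        (hb' a).mul (hb' a').star
      split_ifs with hlt
      · refine (norm_expect_le_of_le (C := 1) _ fun t => ?_).trans (by linarith [sq_nonneg ε])
        rw [norm_mul, AddChar.norm_apply, one_mul]
        exact hb2.norm_le t
      · obtain ⟨hd, hcoef⟩ := natDegree_comp_sub_comp_le hp a a'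
        rw [zero_add]
        refine hM' N _ hd ?_ n _ hb2
        rw [not_lt] at hlt
        refine hlt.trans (le_of_eq ?_)
        congr 1
        -- The factorial in the hypothesis absorbs the degree factor produced by differencing, so c
        -- is simply multiplied by a' − a.
        rw [hcoef, hc, Nat.factorial_succ (m + 1)]
        push_cast
        ring
    refine (Finset.expect_le_expect fun a _ => Finset.expect_le_expect fun a' _ => h2 a a').trans ?_
    have h4 : ∀ a : ZMod N, 𝔼 a' : ZMod N, ((if addOrderOf (c * (a' - a)) < M' then (1 : ℝ) else 0) +
        ε ^ 2 / 2) ≤ ε ^ 2 := by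
      intro a
      rw [Finset.expect_add_distrib, Fintype.expect_const,
        Fintype.expect_equiv (Equiv.subRight a) (fun a' => if addOrderOf (c * (a' - a)) < M'
          then (1 : ℝ) else 0) (fun d => if addOrderOf (c * d) < M' then (1 : ℝ)
          else 0) (fun _ => rfl)]
      have h5 := expect_addOrderOf_mul_lt_le c M'
      have hMr : (M : ℝ) + 1 ≤ addOrderOf c := by exact_mod_cast hM
      have h6 : (M' : ℝ) ^ 2 / addOrderOf c ≤ ε ^ 2 / 2 := by
        rw [div_lt_iff₀ (by positivity)] at hMpos
        rw [div_le_iff₀ (by linarith [Nat.cast_nonneg (α := ℝ) M])]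
        nlinarith [sq_nonneg ε]
      linarith
    exact Finset.expect_le Finset.univ_nonempty fun a _ => h4 a

end Weyl

/-! ### Calculus of families orthogonal to box tests -/

/-- A family of functions on the groups `ℤ/Nℤ` whose correlations with box tests tend to `0`
as `N → ∞`. -/
def IsBoxSmall (s : ℕ) (F : (N : ℕ) → [NeZero N] → ZMod N → ℂ) : Prop :=
  ∀ ε : ℝ, 0 < ε → ∃ N₀ : ℕ, ∀ (N : ℕ) [NeZero N], N₀ ≤ N →
    ∀ (n : ZMod N) (b : (Fin s → ZMod N) → ℂ), IsBoxTest s b →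
      ‖𝔼 t : Fin s → ZMod N, F N (n - ∑ i, t i) * b t‖ ≤ ε

section Small
variable {s : ℕ} {F F' : (N : ℕ) → [NeZero N] → ZMod N → ℂ}

theorem IsBoxSmall.zero (s : ℕ) : IsBoxSmall s (fun _ _ _ => 0) :=
  fun ε hε => ⟨0, fun N _ _ n b _ => by simpa using hε.le⟩

theorem IsBoxSmall.add (h : IsBoxSmall s F) (h' : IsBoxSmall s F') :
    IsBoxSmall s (fun N _ x => F N x + F' N x) := by
  intro ε hε
  obtain ⟨N₁, h₁⟩ := h (ε / 2) (by positivity)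
  obtain ⟨N₂, h₂⟩ := h' (ε / 2) (by positivity)
  refine ⟨max N₁ N₂, fun N _ hN n b hb => ?_⟩
  simp_rw [add_mul, Finset.expect_add_distrib]
  refine (norm_add_le _ _).trans ?_
  linarith [h₁ N (le_of_max_le_left hN) n b hb, h₂ N (le_of_max_le_right hN) n b hb]

theorem IsBoxSmall.const_mul (h : IsBoxSmall s F) (c : ℂ) :
    IsBoxSmall s (fun N _ x => c * F N x) := by
  intro ε hε
  obtain ⟨N₁, h₁⟩ := h (ε / (‖c‖ + 1)) (by positivity)
  refine ⟨N₁, fun N _ hN n b hb => ?_⟩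
  simp_rw [mul_assoc]
  rw [← Finset.mul_expect, norm_mul]
  have := h₁ N hN n b hb
  rw [le_div_iff₀ (by positivity)] at this
  nlinarith [norm_nonneg c, norm_nonneg (𝔼 t : Fin s → ZMod N, F N (n - ∑ i, t i) * b t)]

theorem IsBoxSmall.sum {ι : Type*} (S : Finset ι)
    {F : ι → (N : ℕ) → [NeZero N] → ZMod N → ℂ} (h : ∀ i ∈ S, IsBoxSmall s (F i)) :
    IsBoxSmall s (fun N _ x => ∑ i ∈ S, F i N x) := by
  classical
  induction S using Finset.induction_on with
  | empty => simpa using IsBoxSmall.zero s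
  | insert i S hi ih =>
    have := (h i (Finset.mem_insert_self i S)).add
      (ih fun j hj => h j (Finset.mem_insert_of_mem hj))
    simpa only [Finset.sum_insert hi] using this

theorem expect_sub_sum {G M : Type*} [Fintype G] [AddCommGroup G] [AddCommMonoid M] [Module ℚ≥0 M]
    (s : ℕ) (g : G → M) (n : G) : 𝔼 t : Fin (s + 1) → G, g (n - ∑ i, t i) = 𝔼 x, g x := by
  rw [expect_cons, Finset.expect_comm]
  have : ∀ t : Fin s → G, 𝔼 a : G, g (n - ∑ i, (Fin.cons a t : Fin (s + 1) → G) i) =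
      𝔼 x, g x := by
    intro t
    refine Fintype.expect_equiv (Equiv.subLeft (n - ∑ i, t i)) _ _ fun a => ?_
    rw [Fin.sum_cons, Equiv.subLeft_apply, sub_sub, add_comm]
  simp_rw [this]
  rw [Fintype.expect_const]

theorem norm_expect_mul_isBoxTest_le {N : ℕ} [NeZero N] (g : ZMod N → ℂ) (n : ZMod N)
    {b : (Fin (s + 1) → ZMod N) → ℂ} (hb : IsBoxTest (s + 1) b) :
    ‖𝔼 t : Fin (s + 1) → ZMod N, g (n - ∑ i, t i) * b t‖ ≤ 𝔼 x, ‖g x‖ := by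
  rw [← expect_sub_sum s (fun x => ‖g x‖) n]
  refine (norm_expect_le _).trans (Finset.expect_le_expect fun t _ => ?_)
  rw [norm_mul]
  exact mul_le_of_le_one_right (norm_nonneg _) (hb.norm_le t)

/-- Box tests are 1-bounded and, with at least one variable, n − Σ t_i is uniformly distributed; so
an L¹ error costs no more than its size. -/
theorem IsBoxSmall.of_approx (h : ∀ ε : ℝ, 0 < ε → ∃ F' : (N : ℕ) → [NeZero N] → ZMod N → ℂ,
    IsBoxSmall (s + 1) F' ∧ ∃ N₀ : ℕ, ∀ (N : ℕ) [NeZero N], N₀ ≤ N →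
      𝔼 x, ‖F N x - F' N x‖ ≤ ε) : IsBoxSmall (s + 1) F := by
  intro ε hε
  obtain ⟨F', hF', N₁, h₁⟩ := h (ε / 2) (by positivity)
  obtain ⟨N₂, h₂⟩ := hF' (ε / 2) (by positivity)
  refine ⟨max N₁ N₂, fun N _ hN n b hb => ?_⟩
  have e : ∀ t : Fin (s + 1) → ZMod N, F N (n - ∑ i, t i) * b t =
      (F N (n - ∑ i, t i) - F' N (n - ∑ i, t i)) * b t + F' N (n - ∑ i, t i) * b t :=
    fun t => by ring
  simp_rw [e]
  rw [Finset.expect_add_distrib]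
  refine (norm_add_le _ _).trans ?_
  have h3 := norm_expect_mul_isBoxTest_le (fun x => F N x - F' N x) n hb
  linarith [h₁ N (le_of_max_le_left hN), h₂ N (le_of_max_le_right hN) n b hb]

theorem IsBoxSmall.expect (h : IsBoxSmall (s + 1) F) {ε : ℝ} (hε : 0 < ε) :
    ∃ N₀ : ℕ, ∀ (N : ℕ) [NeZero N], N₀ ≤ N → ‖𝔼 x, F N x‖ ≤ ε := by
  obtain ⟨N₀, h₀⟩ := h ε hε
  refine ⟨N₀, fun N _ hN => ?_⟩
  have := h₀ N hN 0 _ (IsBoxTest.one _)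
  simp only [mul_one] at this
  rwa [expect_sub_sum s (fun x => F N x)] at this

/-- In one variable a box test is constant, so only the mean matters. -/
theorem IsBoxSmall.of_expect
    (h : ∀ ε : ℝ, 0 < ε → ∃ N₀ : ℕ, ∀ (N : ℕ) [NeZero N], N₀ ≤ N → ‖𝔼 x, F N x‖ ≤ ε) :
    IsBoxSmall 1 F := by
  intro ε hε
  obtain ⟨N₀, h₀⟩ := h ε hε
  refine ⟨N₀, fun N _ hN n b ⟨β, b', hβ, hb', hb⟩ => ?_⟩
  have hbc : ∀ t, b t = β 0 := by
    intro t
    rw [← Fin.cons_self_tail t, hb, hb' _ _, mul_one, Subsingleton.elim (Fin.tail t) 0]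
  simp_rw [hbc]
  rw [← Finset.expect_mul, expect_sub_sum 0 (fun x => F N x), norm_mul]
  exact (mul_le_of_le_one_right (norm_nonneg _) (hβ 0)).trans (h₀ N hN)

end Small

/-! ### Weighted equidistribution on the circle -/

section Circle
open MeasureTheory AddCircle

/-- Two continuous functions on the circle which bound the indicator function of a set with null
boundary up to a small error in `L¹`. -/
theorem exists_continuous_approx_indicator (μ : Measure UnitAddCircle) [IsProbabilityMeasure μ]
    {J : Set UnitAddCircle} (hJ : MeasurableSet J)
    (hfr : μ (frontier J) = 0) {ε : ℝ} (hε : 0 < ε) :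
    ∃ χ ψ : C(UnitAddCircle, ℝ), (∀ x, |J.indicator 1 x - χ x| ≤ ψ x) ∧ ∫ x, ψ x ∂μ ≤ ε := by
  have hδ : ∀ n : ℕ, (0 : ℝ) < 1 / ((n : ℝ) + 1) := fun n => by positivity
  have h1 := tendsto_integral_thickenedIndicator_of_isClosed μ (isClosed_closure (s := J)) hδ
    tendsto_one_div_add_atTop_nhds_zero_nat
  have h2 := tendsto_integral_thickenedIndicator_of_isClosed μ (isClosed_closure (s := Jᶜ)) hδ
    tendsto_one_div_add_atTop_nhds_zero_nat
  have h3 : μ.real (closure J) + μ.real (closure Jᶜ) = 1 := by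
    rw [measureReal_def, measureReal_def, measure_closure_of_null_frontier hfr,
      measure_closure_of_null_frontier (by rwa [frontier_compl]), ← measureReal_def,
      ← measureReal_def, measureReal_compl hJ]
    simp
  have h4 := h1.add h2
  rw [h3] at h4
  obtain ⟨n, hn⟩ := (h4.eventually (gt_mem_nhds (show (1 : ℝ) < 1 + ε by linarith))).exists
  let χ : C(UnitAddCircle, ℝ) := ⟨fun x => (thickenedIndicator (hδ n) (closure J) x : ℝ), by fun_prop⟩
  let χ' : C(UnitAddCircle, ℝ) := ⟨fun x => (thickenedIndicator (hδ n) (closure Jᶜ) x : ℝ), by fun_prop⟩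
  -- χ and χ' are thickenings of J and of its complement. They overshoot only near the boundary, and
  -- the integral of χ + χ' tends to 1 because the boundary is null.
  refine ⟨χ, χ + χ' - 1, fun x => ?_, ?_⟩
  · have hχ0 : 0 ≤ χ x := NNReal.coe_nonneg _
    have hχ0' : 0 ≤ χ' x := NNReal.coe_nonneg _
    have hχ1 : χ x ≤ 1 := thickenedIndicator_le_one (hδ n) (closure J) x
    have hχ1' : χ' x ≤ 1 := thickenedIndicator_le_one (hδ n) (closure Jᶜ) x
    simp only [ContinuousMap.sub_apply, ContinuousMap.add_apply, ContinuousMap.one_apply]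
    by_cases hx : x ∈ J
    · have : χ x = 1 := by
        simp only [χ, ContinuousMap.coe_mk]
        rw [thickenedIndicator_one (hδ n) _ (subset_closure hx)]
        rfl
      rw [Set.indicator_of_mem hx, this]
      simpa using hχ0'
    · have : χ' x = 1 := by
        simp only [χ', ContinuousMap.coe_mk]
        rw [thickenedIndicator_one (hδ n) _ (subset_closure (Set.mem_compl hx))]
        rfl
      rw [Set.indicator_of_notMem hx, this, zero_sub, abs_neg, abs_of_nonneg hχ0]
      linarith
  · have e : ∀ x, (χ + χ' - 1) x = (thickenedIndicator (hδ n) (closure J) x : ℝ) +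
        (thickenedIndicator (hδ n) (closure Jᶜ) x : ℝ) - 1 := fun x => rfl
    simp_rw [e]
    have i1 := integrable_thickenedIndicator (μ := μ) (closure J) (hδ n)
    have i2 := integrable_thickenedIndicator (μ := μ) (closure Jᶜ) (hδ n)
    have e2 := integral_sub (i1.add i2) (integrable_const (1 : ℝ))
    simp only [Pi.add_apply] at e2
    rw [e2, integral_add i1 i2]
    simp only [integral_const, probReal_univ, smul_eq_mul, mul_one]
    linarith

theorem integral_fourier_eq_zero {m : ℤ} (hm : m ≠ 0) :
    ∫ x : UnitAddCircle, fourier m x ∂haarAddCircle = 0 := by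
  have h := fourierCoeff_fourier (T := 1) m
  have h2 := congrFun h 0
  rw [fourierCoeff] at h2
  simpa [hm, hm.symm] using h2

theorem continuousMap_fourier_induction {p : C(UnitAddCircle, ℂ) → Prop}
    (fourier : ∀ m, p (fourier m)) (zero : p 0) (add : ∀ f g, p f → p g → p (f + g))
    (smul : ∀ (c : ℂ) f, p f → p (c • f))
    (closure : ∀ f, (∀ ε : ℝ, 0 < ε → ∃ g, p g ∧ ‖f - g‖ ≤ ε) → p f) (f) : p f := by
  have hf : f ∈ (Submodule.span ℂ (Set.range <| @_root_.fourier 1)).topologicalClosure := by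
    rw [span_fourier_closure_eq_top]
    trivial
  refine closure f fun ε hε => ?_
  obtain ⟨g, hg, hfg⟩ := Metric.mem_closure_iff.1 hf ε hε
  refine ⟨g, ?_, by rw [← dist_eq_norm]; exact hfg.le⟩
  refine Submodule.span_induction (p := fun g _ => p g) ?_ zero (fun f g _ _ => add f g)
    (fun c f _ => smul c f) hg
  rintro _ ⟨m, rfl⟩
  exact fourier m

variable {s : ℕ} {X : (N : ℕ) → [NeZero N] → ZMod N → UnitAddCircle}
  {W : (N : ℕ) → [NeZero N] → ZMod N → ℂ}

theorem norm_integral_haarAddCircle_le (f : C(UnitAddCircle, ℂ)) :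
    ‖∫ x, f x ∂haarAddCircle‖ ≤ ‖f‖ := by
  simpa using norm_integral_le_of_norm_le_const (μ := (haarAddCircle : Measure UnitAddCircle))
    (ae_of_all _ fun x => f.norm_coe_le_norm x)

theorem integrable_haarAddCircle {E : Type*} [NormedAddCommGroup E] (f : C(UnitAddCircle, E)) :
    Integrable f haarAddCircle :=
  f.continuous.integrable_of_hasCompactSupport (HasCompactSupport.of_compactSpace f)

/-- Weyl's criterion with a bounded weight W: the hypothesis handles nonconstant characters, and
density of trigonometric polynomials does the rest. -/
theorem IsBoxSmall.continuousMap (hW : ∀ (N : ℕ) [NeZero N] (x : ZMod N), ‖W N x‖ ≤ 1)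
    (h : ∀ m : ℤ, m ≠ 0 → IsBoxSmall (s + 1) fun N _ x => fourier m (X N x) * W N x)
    (f : C(UnitAddCircle, ℂ)) :
    IsBoxSmall (s + 1) fun N _ x => (f (X N x) - ∫ y, f y ∂haarAddCircle) * W N x := by
  induction f using continuousMap_fourier_induction with
  | fourier m =>
    rcases eq_or_ne m 0 with rfl | hm
    · simpa using IsBoxSmall.zero (s + 1)
    · simpa only [integral_fourier_eq_zero hm, sub_zero] using h m hm
  | zero => simpa using IsBoxSmall.zero (s + 1)
  | add f g hf hg =>
    have := hf.add hg
    convert this using 4 with N _ x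
    simp only [ContinuousMap.add_apply]
    rw [integral_add (integrable_haarAddCircle f) (integrable_haarAddCircle g)]
    ring
  | smul c f hf =>
    have := hf.const_mul c
    convert this using 4 with N _ x
    simp only [ContinuousMap.smul_apply, smul_eq_mul]
    rw [integral_const_mul]
    ring
  | closure f hf =>
    refine IsBoxSmall.of_approx fun ε hε => ?_
    obtain ⟨g, hg, hfg⟩ := hf (ε / 2) (by positivity)
    refine ⟨_, hg, 0, fun N _ _ => Finset.expect_le Finset.univ_nonempty fun x _ => ?_⟩
    rw [← sub_mul, norm_mul]
    refine (mul_le_of_le_one_right (norm_nonneg _) (hW N x)).trans ?_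
    have e : f (X N x) - ∫ y, f y ∂haarAddCircle - (g (X N x) - ∫ y, g y ∂haarAddCircle) =
        (f - g) (X N x) - ∫ y, (f - g) y ∂haarAddCircle := by
      simp only [ContinuousMap.sub_apply]
      rw [integral_sub (integrable_haarAddCircle f) (integrable_haarAddCircle g)]
      ring
    rw [e]
    refine (norm_sub_le _ _).trans ?_
    linarith [(f - g).norm_coe_le_norm (X N x), norm_integral_haarAddCircle_le (f - g)]

theorem expect_continuousMap_le (hX : ∀ m : ℤ, m ≠ 0 → IsBoxSmall 1 fun N _ x => fourier m (X N x))
    (ψ : C(UnitAddCircle, ℝ)) {ε : ℝ} (hε : 0 < ε) : ∃ N₀ : ℕ, ∀ (N : ℕ) [NeZero N], N₀ ≤ N →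
      𝔼 x, ψ (X N x) ≤ ∫ y, ψ y ∂haarAddCircle + ε := by
  let f : C(UnitAddCircle, ℂ) := ⟨fun x => (ψ x : ℂ), by fun_prop⟩
  have h := IsBoxSmall.continuousMap (s := 0) (X := X) (W := fun _ _ _ => 1) (by simp)
    (by simpa using hX) f
  obtain ⟨N₀, h₀⟩ := h.expect hε
  refine ⟨N₀, fun N _ hN => ?_⟩
  have := h₀ N hN
  simp only [mul_one] at this
  have e : 𝔼 x, (f (X N x) - ∫ y, f y ∂haarAddCircle) =
      ((𝔼 x, ψ (X N x) - ∫ y, ψ y ∂haarAddCircle : ℝ) : ℂ) := by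
    rw [Finset.expect_sub_distrib, Fintype.expect_const, Complex.ofReal_sub, Complex.ofReal_expect,
      ← integral_complex_ofReal]
    rfl
  rw [e, Complex.norm_real] at this
  linarith [le_of_abs_le this]

/-- Passage from continuous functions to arcs. The unweighted equidistribution `hX` controls the L¹
error, since the majorant ψ of the approximation error then has mean close to its small integral. -/
theorem IsBoxSmall.indicator (hW : ∀ (N : ℕ) [NeZero N] (x : ZMod N), ‖W N x‖ ≤ 1)
    (h : ∀ m : ℤ, m ≠ 0 → IsBoxSmall (s + 1) fun N _ x => fourier m (X N x) * W N x)
    (hX : ∀ m : ℤ, m ≠ 0 → IsBoxSmall 1 fun N _ x => fourier m (X N x))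
    {J : Set UnitAddCircle} (hJ : MeasurableSet J) (hfr : haarAddCircle (frontier J) = 0) :
    IsBoxSmall (s + 1) fun N _ x =>
      (J.indicator 1 (X N x) - (haarAddCircle.real J : ℂ)) * W N x := by
  refine IsBoxSmall.of_approx fun ε hε => ?_
  obtain ⟨χ, ψ, hχ, hψ⟩ := exists_continuous_approx_indicator haarAddCircle hJ hfr
    (show 0 < ε / 3 by positivity)
  let f : C(UnitAddCircle, ℂ) := ⟨fun x => (χ x : ℂ), by fun_prop⟩
  obtain ⟨N₀, h₀⟩ := expect_continuousMap_le hX ψ (show 0 < ε / 3 by positivity)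
  refine ⟨_, IsBoxSmall.continuousMap hW h f, N₀, fun N _ hN => ?_⟩
  have hint : |haarAddCircle.real J - ∫ y, χ y ∂haarAddCircle| ≤ ε / 3 := by
    rw [← integral_indicator_one hJ, ← integral_sub
      (show Integrable (J.indicator (1 : UnitAddCircle → ℝ)) haarAddCircle from
        (integrable_const (1 : ℝ)).indicator hJ) (integrable_haarAddCircle χ)]
    refine (abs_integral_le_integral_abs).trans ((integral_mono_of_nonneg
      (ae_of_all _ fun x => abs_nonneg _) (integrable_haarAddCircle ψ)
      (ae_of_all _ fun x => hχ x)).trans hψ)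
  have hpt : ∀ x : ZMod N, ‖(J.indicator 1 (X N x) - (haarAddCircle.real J : ℂ)) * W N x -
      (f (X N x) - ∫ y, f y ∂haarAddCircle) * W N x‖ ≤ ψ (X N x) + ε / 3 := by
    intro x
    rw [← sub_mul, norm_mul]
    refine (mul_le_of_le_one_right (norm_nonneg _) (hW N x)).trans ?_
    have e : (J.indicator 1 (X N x) - (haarAddCircle.real J : ℂ)) -
        (f (X N x) - ∫ y, f y ∂haarAddCircle) =
        ((J.indicator 1 (X N x) - χ (X N x) -
          (haarAddCircle.real J - ∫ y, χ y ∂haarAddCircle) : ℝ) : ℂ) := by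
      simp only [Complex.ofReal_sub, ← integral_complex_ofReal]
      have : ((J.indicator (1 : UnitAddCircle → ℝ) (X N x) : ℝ) : ℂ) =
          J.indicator (1 : UnitAddCircle → ℂ) (X N x) := by
        by_cases hx : X N x ∈ J <;> simp [hx]
      rw [this]
      simp only [f, ContinuousMap.coe_mk]
      ring
    rw [e, Complex.norm_real]
    exact (abs_sub _ _).trans (add_le_add (hχ _) hint)
  refine (Finset.expect_le_expect fun x _ => hpt x).trans ?_
  rw [Finset.expect_add_distrib, Fintype.expect_const]
  linarith [h₀ N hN]

/-- The arc of the circle of length `L` which starts at `a`. -/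
def circleArc (a L : ℝ) : Set UnitAddCircle := ((↑) : ℝ → UnitAddCircle) '' Set.Ico a (a + L)

theorem haarAddCircle_eq_volume : (haarAddCircle : Measure UnitAddCircle) = volume := by
  rw [volume_eq_smul_haarAddCircle]
  simp

theorem measurableSet_circleArc (a : ℝ) {L : ℝ} (hL : L ≤ 1) : MeasurableSet (circleArc a L) := by
  have : circleArc a L = (AddCircle.measurableEquivIco 1 a) ⁻¹' (Subtype.val ⁻¹' Set.Iio (a + L)) := by
    ext x
    simp only [circleArc, Set.mem_image, Set.mem_preimage, Set.mem_Iio]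
    constructor
    · rintro ⟨y, hy, rfl⟩
      have : (AddCircle.measurableEquivIco 1 a (y : UnitAddCircle) : ℝ) = y :=
        (AddCircle.coe_eq_coe_iff_of_mem_Ico (AddCircle.measurableEquivIco 1 a y).2
          ⟨hy.1, hy.2.trans_le (by linarith)⟩).1
          ((AddCircle.measurableEquivIco 1 a).symm_apply_apply (y : UnitAddCircle))
      rw [this]
      exact hy.2
    · intro h
      exact ⟨_, ⟨(AddCircle.measurableEquivIco 1 a x).2.1, h⟩,
        (AddCircle.measurableEquivIco 1 a).symm_apply_apply x⟩
  rw [this]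
  exact (AddCircle.measurableEquivIco 1 a).measurable (measurable_subtype_coe measurableSet_Iio)

theorem haarAddCircle_real_circleArc (a : ℝ) {L : ℝ} (hL0 : 0 ≤ L) (hL : L ≤ 1) :
    haarAddCircle.real (circleArc a L) = L := by
  rw [haarAddCircle_eq_volume, measureReal_def,
    add_projection_respects_measure 1 a (measurableSet_circleArc a hL)]
  have h1 : (QuotientAddGroup.mk ⁻¹' circleArc a L ∩ Set.Ioc a (a + 1) : Set ℝ) =ᵐ[volume]
      (QuotientAddGroup.mk ⁻¹' circleArc a L ∩ Set.Ico a (a + 1) : Set ℝ) :=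
    (ae_eq_refl _).inter Ico_ae_eq_Ioc.symm
  have h2 : (QuotientAddGroup.mk ⁻¹' circleArc a L ∩ Set.Ico a (a + 1) : Set ℝ) =
      Set.Ico a (a + L) := by
    ext x
    constructor
    · rintro ⟨⟨y, hy, hxy⟩, hx⟩
      have : y = x := (AddCircle.coe_eq_coe_iff_of_mem_Ico (p := 1) (a := a)
        ⟨hy.1, hy.2.trans_le (by linarith)⟩ hx).1 hxy
      exact this ▸ hy
    · intro hx
      exact ⟨⟨x, hx, rfl⟩, hx.1, hx.2.trans_le (by linarith)⟩
  rw [measure_congr h1, h2, Real.volume_Ico]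
  simp [hL0]

theorem haarAddCircle_frontier_circleArc (a L : ℝ) :
    haarAddCircle (frontier (circleArc a L)) = 0 := by
  have h1 : closure (circleArc a L) ⊆ ((↑) : ℝ → UnitAddCircle) '' Set.Icc a (a + L) :=
    closure_minimal (Set.image_mono Set.Ico_subset_Icc_self)
      (isCompact_Icc.image (AddCircle.continuous_mk' 1)).isClosed
  have h2 : ((↑) : ℝ → UnitAddCircle) '' Set.Ioo a (a + L) ⊆ interior (circleArc a L) :=
    interior_maximal (Set.image_mono Set.Ioo_subset_Ico_self)
      (QuotientAddGroup.isOpenMap_coe _ isOpen_Ioo)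
  have h3 : frontier (circleArc a L) ⊆ {(a : UnitAddCircle), ((a + L : ℝ) : UnitAddCircle)} := by
    rintro x ⟨hx, hx'⟩
    obtain ⟨y, hy, rfl⟩ := h1 hx
    rcases hy.1.eq_or_lt with rfl | h
    · simp
    rcases hy.2.eq_or_lt with rfl | h'
    · simp
    exact absurd (h2 ⟨y, ⟨h, h'⟩, rfl⟩) hx'
  rw [haarAddCircle_eq_volume]
  have h4 : ∀ x : UnitAddCircle, volume {x} = 0 := fun x => by
    rw [← Metric.closedBall_zero, AddCircle.volume_closedBall]
    simp
  exact measure_mono_null h3 (measure_union_null (h4 _) (h4 _))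

end Circle

/-! ### Uniformity of the phase sets -/

section Phase
open Polynomial

theorem fourier_toAddCircle {N : ℕ} [NeZero N] (m : ℤ) (x : ZMod N) :
    fourier m (ZMod.toAddCircle x) = ZMod.stdAddChar ((m : ZMod N) * x) := by
  rw [fourier_apply, ← map_zsmul, zsmul_eq_mul]
  rfl

theorem le_addOrderOf_intCast_mul {N : ℕ} [NeZero N] {c : ℤ} (hc : c ≠ 0) :
    N ≤ addOrderOf (c : ZMod N) * c.natAbs := by
  have h : (((addOrderOf (c : ZMod N) : ℤ) * c : ℤ) : ZMod N) = 0 := by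
    push_cast
    rw [← nsmul_eq_mul, addOrderOf_nsmul_eq_zero]
  rw [ZMod.intCast_zmod_eq_zero_iff_dvd] at h
  have h2 := Int.natAbs_dvd_natAbs.2 h
  rw [Int.natAbs_mul, Int.natAbs_natCast, Int.natAbs_natCast] at h2
  exact Nat.le_of_dvd (Nat.mul_pos (addOrderOf_pos _) (Int.natAbs_pos.2 hc)) h2

theorem isBoxSmall_phase (s : ℕ) {m : ℤ} (hm : m ≠ 0) (r : ℤ) :
    IsBoxSmall (s + 2) fun _ _ x =>
      fourier r (ZMod.toAddCircle x) * fourier m (ZMod.toAddCircle (x ^ (s + 2))) := by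
  intro ε hε
  obtain ⟨M, hM⟩ := norm_expect_polynomial_phase_le (s + 1) ε hε
  set c : ℤ := (s + 2).factorial * m with hc
  have hc0 : c ≠ 0 := mul_ne_zero (by positivity) hm
  -- The relevant leading coefficient is the fixed nonzero integer c, whose order modulo N is at
  -- least N/|c|. The linear term is harmless because the degree s + 2 exceeds 1.
  refine ⟨M * c.natAbs, fun N _ hN n b hb => ?_⟩
  set p : (ZMod N)[X] := C (m : ZMod N) * X ^ (s + 2) + C (r : ZMod N) * X with hp
  have hdeg : p.natDegree ≤ s + 2 := by
    refine natDegree_add_le_of_degree_le (natDegree_C_mul_X_pow_le _ _) ?_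
    exact (natDegree_C_mul_le _ _).trans (natDegree_X_le.trans (by omega))
  have hcoef : p.coeff (s + 2) = m := by
    rw [hp, coeff_add, coeff_C_mul_X_pow, if_pos rfl, coeff_C_mul, coeff_X, if_neg (by omega),
      mul_zero, add_zero]
  have he : ∀ x : ZMod N, fourier r (ZMod.toAddCircle x) *
      fourier m (ZMod.toAddCircle (x ^ (s + 2))) = ZMod.stdAddChar (p.eval x) := by
    intro x
    rw [fourier_toAddCircle, fourier_toAddCircle, ← AddChar.map_add_eq_mul]
    simp [hp, add_comm]
  simp_rw [he]
  refine hM N p hdeg ?_ n b hb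
  have h1 := le_addOrderOf_intCast_mul (N := N) hc0
  have h2 : (((s + 1 + 1).factorial : ZMod N) * p.coeff (s + 1 + 1)) = (c : ZMod N) := by
    rw [hcoef, hc]
    push_cast
    rfl
  rw [h2]
  exact Nat.le_of_mul_le_mul_right (hN.trans h1) (Int.natAbs_pos.2 hc0)

theorem isBoxSmall_one_fourier_toAddCircle {m : ℤ} (hm : m ≠ 0) :
    IsBoxSmall 1 fun _ _ x => fourier m (ZMod.toAddCircle x) := by
  refine IsBoxSmall.of_expect fun ε hε => ⟨m.natAbs + 1, fun N _ hN => ?_⟩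
  simp_rw [fourier_toAddCircle]
  rw [expect_stdAddChar_linear, norm_zero]
  · exact hε.le
  · rw [Ne, ZMod.intCast_zmod_eq_zero_iff_dvd]
    intro h
    have := Int.natAbs_dvd_natAbs.2 h
    rw [Int.natAbs_natCast] at this
    have := Nat.le_of_dvd (Int.natAbs_pos.2 hm) this
    omega

theorem isBoxSmall_one_fourier_pow (s : ℕ) {m : ℤ} (hm : m ≠ 0) :
    IsBoxSmall 1 fun _ _ x => fourier m (ZMod.toAddCircle (x ^ (s + 2))) := by
  refine IsBoxSmall.of_expect fun ε hε => ?_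
  simpa using (isBoxSmall_phase s hm 0).expect hε

theorem toAddCircle_mem_circleArc_iff {N : ℕ} [NeZero N] {M j : ℕ} (hj : j < M) (x : ZMod N) :
    ZMod.toAddCircle x ∈ circleArc (j / M) (1 / M) ↔ M * x.val / N = j := by
  have hM : (0 : ℝ) < M := by exact_mod_cast (Nat.zero_le j).trans_lt hj
  have hN : (0 : ℝ) < N := by exact_mod_cast NeZero.pos N
  rw [Nat.div_eq_iff (NeZero.pos N), ZMod.toAddCircle_apply, circleArc]
  have key : (x.val / N : ℝ) ∈ Set.Ico ((j : ℝ) / M) (j / M + 1 / M) ↔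
      j * N ≤ M * x.val ∧ M * x.val < (j + 1) * N := by
    rw [Set.mem_Ico, ← add_div, div_le_div_iff₀ hM hN, div_lt_div_iff₀ hN hM, mul_comm (x.val : ℝ)]
    norm_cast
  have hx0 : (x.val / N : ℝ) ∈ Set.Ico (0 : ℝ) (0 + 1) :=
    ⟨by positivity, by rw [zero_add, div_lt_one hN]; exact_mod_cast x.val_lt⟩
  have : ((x.val / N : ℝ) : UnitAddCircle) ∈
      ((↑) : ℝ → UnitAddCircle) '' Set.Ico ((j : ℝ) / M) (j / M + 1 / M) ↔
      (x.val / N : ℝ) ∈ Set.Ico ((j : ℝ) / M) (j / M + 1 / M) := by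
    refine ⟨?_, fun h => ⟨_, h, rfl⟩⟩
    rintro ⟨y, hy, hxy⟩
    have hy' : y ∈ Set.Ico (0 : ℝ) (0 + 1) := by
      refine ⟨le_trans (by positivity) hy.1, hy.2.trans_le ?_⟩
      rw [← add_div, zero_add, div_le_one hM]
      exact_mod_cast hj
    rw [AddCircle.coe_eq_coe_iff_of_mem_Ico hy' hx0] at hxy
    rwa [← hxy]
  rw [this, key]
  have := NeZero.pos N
  constructor
  · rintro ⟨h1, h2⟩
    rw [add_mul] at h2
    omega
  · rintro ⟨h1, h2⟩
    rw [add_mul]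
    omega

/-- The points `n` of `ℤ/Nℤ` for which `n ^ s / N` lies in an arc of length `α` whose
starting point depends on the position of `n` among `M` consecutive intervals. -/
def phaseSet (s M : ℕ) (γ : ℕ → ℝ) (α : ℝ) (N : ℕ) [NeZero N] : Set (ZMod N) :=
  {n | ZMod.toAddCircle (n ^ s) ∈ circleArc (γ (M * n.val / N)) α}

theorem isBoxSmall_phaseSet (s : ℕ) {M : ℕ} (hM : 0 < M) (γ : ℕ → ℝ) {α : ℝ} (hα0 : 0 ≤ α)
    (hα1 : α ≤ 1) : IsBoxSmall (s + 2) fun N _ n =>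
      (phaseSet (s + 2) M γ α N).indicator 1 n - (α : ℂ) := by
  have hM1 : (1 : ℝ) / M ≤ 1 := by
    rw [div_le_one (by exact_mod_cast hM)]
    exact_mod_cast hM
  -- `IsBoxSmall.indicator` is used twice with roles exchanged: here x/N is cut to an interval with
  -- the phase of x^(s+2) as weight, below x^(s+2) is cut to an arc with the interval as weight.
  have h1 : ∀ j < M, ∀ m : ℤ, m ≠ 0 → IsBoxSmall (s + 2) fun N _ x =>
      fourier m (ZMod.toAddCircle (x ^ (s + 2))) *
        (circleArc (j / M) (1 / M)).indicator 1 (ZMod.toAddCircle x) := by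
    intro j hj m hm
    have h2 := IsBoxSmall.indicator (s := s + 1) (X := fun N _ x => ZMod.toAddCircle x)
      (W := fun N _ x => fourier m (ZMod.toAddCircle (x ^ (s + 2)))) (fun N _ x => by
        rw [fourier_toAddCircle, AddChar.norm_apply])
      (fun r _ => isBoxSmall_phase s hm r) (fun r hr => isBoxSmall_one_fourier_toAddCircle hr)
      (measurableSet_circleArc (j / M) hM1) (haarAddCircle_frontier_circleArc _ _)
    have h3 := (isBoxSmall_phase s hm 0).const_mul
      (AddCircle.haarAddCircle.real (circleArc (j / M) (1 / M)) : ℂ)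
    convert h2.add h3 using 4 with N _ x
    simp only [fourier_zero]
    ring
  have h4 : ∀ j ∈ Finset.range M, IsBoxSmall (s + 2) fun N _ x =>
      ((circleArc (γ j) α).indicator 1 (ZMod.toAddCircle (x ^ (s + 2))) - (α : ℂ)) *
        (circleArc (j / M) (1 / M)).indicator 1 (ZMod.toAddCircle x) := by
    intro j hj
    have h5 := IsBoxSmall.indicator (s := s + 1)
      (X := fun N _ x => ZMod.toAddCircle (x ^ (s + 2)))
      (W := fun N _ x => (circleArc (j / M) (1 / M)).indicator 1 (ZMod.toAddCircle x))
      (fun N _ x => by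
        by_cases hx : ZMod.toAddCircle x ∈ circleArc (j / M) (1 / M)
        · simp only [Set.indicator_of_mem hx, Pi.one_apply, norm_one, le_refl]
        · simp only [Set.indicator_of_notMem hx, norm_zero, zero_le_one])
      (h1 j (Finset.mem_range.1 hj)) (fun r hr => isBoxSmall_one_fourier_pow s hr)
      (measurableSet_circleArc (γ j) hα1) (haarAddCircle_frontier_circleArc _ _)
    rwa [haarAddCircle_real_circleArc (γ j) hα0 hα1] at h5
  convert IsBoxSmall.sum (Finset.range M) h4 using 4 with N _ x
  have hlt : M * x.val / N < M := by
    rw [Nat.div_lt_iff_lt_mul (NeZero.pos N)]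
    exact Nat.mul_lt_mul_of_pos_left x.val_lt hM
  rw [Finset.sum_eq_single (M * x.val / N)]
  · rw [Set.indicator_of_mem ((toAddCircle_mem_circleArc_iff hlt x).2 rfl)]
    simp only [Pi.one_apply, mul_one]
    rfl
  · intro j hj hne
    rw [Set.indicator_of_notMem (s := circleArc (j / M) (1 / M)), mul_zero]
    rw [toAddCircle_mem_circleArc_iff (Finset.mem_range.1 hj)]
    exact hne.symm
  · intro h
    exact absurd (Finset.mem_range.2 hlt) h

end Phase

/-! ### Finite differences of even order -/

/-- The coefficients of the `e`-th finite difference. -/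
def diffCoeff (e i : ℕ) : ℤ := (-1) ^ i * e.choose i

theorem sum_diffCoeff_mul_eq_fwdDiff {R : Type*} [CommRing R] {e : ℕ} (he : Even e) (f : R → R) :
    ∑ i ∈ Finset.range (e + 1), (diffCoeff e i : R) * f i = (fwdDiff 1)^[e] f 0 := by
  rw [fwdDiff_iter_eq_sum_shift]
  refine Finset.sum_congr rfl fun i hi => ?_
  have hi' : i ≤ e := Nat.lt_succ_iff.1 (Finset.mem_range.1 hi)
  have : (-1 : ℤ) ^ (e - i) = (-1) ^ i := by
    obtain ⟨a, rfl⟩ := Nat.exists_eq_add_of_le hi'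
    rw [Nat.add_sub_cancel_left]
    exact neg_one_pow_congr (by have := Nat.even_add.1 he; tauto)
  rw [this, zsmul_eq_mul]
  simp [diffCoeff]

theorem sum_diffCoeff_mul_pow_eq_zero {R : Type*} [CommRing R] {e j : ℕ} (he : Even e) (hj : j < e)
    (x y : R) : ∑ i ∈ Finset.range (e + 1), (diffCoeff e i : R) * (x + i * y) ^ j = 0 := by
  rw [sum_diffCoeff_mul_eq_fwdDiff he fun r => (x + r * y) ^ j]
  have h := Polynomial.fwdDiff_iter_eq_zero_of_degree_lt (n := e)
    (P := (Polynomial.C x + Polynomial.X * Polynomial.C y) ^ j) ?_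
  · have hf : (fun r : R => (x + r * y) ^ j) = fun r =>
        ((Polynomial.C x + Polynomial.X * Polynomial.C y) ^ j).eval r := by
      funext r
      simp [mul_comm r y]
    rw [hf, h, Pi.zero_apply]
  · refine lt_of_le_of_lt ?_ hj
    refine (Polynomial.natDegree_pow_le).trans ?_
    refine (Nat.mul_le_mul_left j (show _ ≤ 1 by compute_degree)).trans (by simp)

theorem sum_diffCoeff_mul_pow_self {e : ℕ} (he : Even e) (x y : ℝ) :
    ∑ i ∈ Finset.range (e + 1), (diffCoeff e i : ℝ) * (x + i * y) ^ e = e.factorial * y ^ e := by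
  rcases Nat.eq_zero_or_pos e with rfl | hpos
  · simp [diffCoeff]
  rcases eq_or_ne y 0 with rfl | hy
  · have h := sum_diffCoeff_mul_pow_eq_zero he hpos x (0 : ℝ)
    simp only [pow_zero, mul_one, mul_zero, add_zero] at h ⊢
    rw [← Finset.sum_mul, h]
    simp [hpos.ne']
  · rw [sum_diffCoeff_mul_eq_fwdDiff he fun r => (x + r * y) ^ e]
    have h1 : (fun r : ℝ => (x + r * y) ^ e) = y ^ e • fun r => (r + x / y) ^ e := by
      ext r
      simp only [Pi.smul_apply, smul_eq_mul]
      rw [← mul_pow]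
      congr 1
      field_simp
      ring
    rw [h1, fwdDiff_iter_const_smul]
    have h2 := fwdDiff_iter_comp_add (h := (1 : ℝ)) (fun r : ℝ => r ^ e) (x / y) e 0
    simp only [Pi.smul_apply, smul_eq_mul]
    rw [h2, fwdDiff_iter_eq_factorial]
    simp [mul_comm]

theorem sum_diffCoeff_mul_pow_complex (e : ℕ) (z : ℂ) :
    ∑ i ∈ Finset.range (e + 1), (diffCoeff e i : ℂ) * z ^ i = (1 - z) ^ e := by
  rw [sub_eq_neg_add, add_pow]
  refine Finset.sum_congr rfl fun i _ => ?_
  simp only [diffCoeff, one_pow, mul_one]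
  push_cast
  rw [neg_pow z]
  ring

theorem sum_abs_diffCoeff (e : ℕ) : ∑ i ∈ Finset.range (e + 1), |diffCoeff e i| = 2 ^ e := by
  simp only [diffCoeff, abs_mul, abs_pow, abs_neg, abs_one, one_pow, one_mul, Nat.abs_cast]
  exact_mod_cast Nat.sum_range_choose e

/-- Partial alternating sums of binomial coefficients are ±C(e−1, t−1). Hence the e-th difference
detects any single jump along a progression, which will exclude wrap-around. -/
theorem sum_diffCoeff_lt_ne_zero {e t : ℕ} (ht : 0 < t) (hte : t ≤ e) :
    ∑ i ∈ Finset.range (e + 1), (if i < t then diffCoeff e i else 0) ≠ 0 := by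
  rw [← Finset.sum_filter]
  have : (Finset.range (e + 1)).filter (· < t) = Finset.range (t - 1 + 1) := by
    ext i
    simp only [Finset.mem_filter, Finset.mem_range]
    omega
  rw [this]
  have h := Int.alternating_sum_range_choose_eq_choose (n := e - 1) (m := t - 1)
  rw [Nat.sub_add_cancel (ht.trans_le hte)] at h
  unfold diffCoeff
  rw [h]
  have : 0 < (e - 1).choose (t - 1) := Nat.choose_pos (by omega)
  positivity

theorem sum_diffCoeff_ge_ne_zero {e t : ℕ} (ht : 0 < t) (hte : t ≤ e) :
    ∑ i ∈ Finset.range (e + 1), (if t ≤ i then diffCoeff e i else 0) ≠ 0 := by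
  intro h
  apply sum_diffCoeff_lt_ne_zero ht hte
  have h0 : ∑ i ∈ Finset.range (e + 1), diffCoeff e i = 0 :=
    Int.alternating_sum_range_choose_of_ne (by omega)
  have hs : ∑ i ∈ Finset.range (e + 1), (if i < t then diffCoeff e i else 0) +
      ∑ i ∈ Finset.range (e + 1), (if t ≤ i then diffCoeff e i else 0) =
      ∑ i ∈ Finset.range (e + 1), diffCoeff e i := by
    rw [← Finset.sum_add_distrib]
    refine Finset.sum_congr rfl fun i _ => ?_
    split_ifs <;> omega
  linarith

theorem norm_cexp_sub_cexp_le (a b : ℝ) :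
    ‖Complex.exp (Complex.I * a) - Complex.exp (Complex.I * b)‖ ≤ |a - b| := by
  have : Complex.exp (Complex.I * a) - Complex.exp (Complex.I * b) =
      Complex.exp (b * Complex.I) * (Complex.exp (Complex.I * (a - b : ℝ)) - 1) := by
    rw [mul_sub, ← Complex.exp_add]
    push_cast
    ring_nf
  rw [this, norm_mul, Complex.norm_exp_ofReal_mul_I, one_mul]
  exact Real.norm_exp_I_mul_ofReal_sub_one_le

theorem four_mul_abs_le_norm_one_sub_cexp {θ : ℝ} (hθ : |θ| ≤ 1 / 2) :
    4 * |θ| ≤ ‖1 - Complex.exp (Complex.I * (2 * Real.pi * θ : ℝ))‖ := by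
  rw [norm_sub_rev, Complex.norm_exp_I_mul_ofReal_sub_one, norm_mul, Real.norm_eq_abs,
    Real.norm_eq_abs, abs_two, show 2 * Real.pi * θ / 2 = Real.pi * θ by ring]
  have h := Real.mul_abs_le_abs_sin (x := Real.pi * θ) (by
    rw [abs_mul, abs_of_pos Real.pi_pos]
    nlinarith [Real.pi_pos])
  rw [abs_mul, abs_of_pos Real.pi_pos] at h
  have : 2 / Real.pi * (Real.pi * |θ|) = 2 * |θ| := by field_simp
  linarith

theorem stdAddChar_eq_cexp_val {N : ℕ} [NeZero N] (x : ZMod N) :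
    ZMod.stdAddChar x = Complex.exp (Complex.I * (2 * Real.pi * (x.val / N) : ℝ)) := by
  rw [ZMod.stdAddChar_apply, ZMod.toCircle_apply]
  push_cast
  ring_nf

theorem stdAddChar_eq_cexp_valMinAbs {N : ℕ} [NeZero N] (x : ZMod N) :
    ZMod.stdAddChar x = Complex.exp (Complex.I * (2 * Real.pi * (x.valMinAbs / N) : ℝ)) := by
  conv_lhs => rw [← ZMod.coe_valMinAbs x]
  rw [ZMod.stdAddChar_coe]
  push_cast
  ring_nf

theorem abs_valMinAbs_div_le {N : ℕ} [NeZero N] (y : ZMod N) : |(y.valMinAbs / N : ℝ)| ≤ 1 / 2 := by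
  have hN : (0 : ℝ) < N := by exact_mod_cast NeZero.pos N
  have h := ZMod.valMinAbs_mem_Ioc y
  rw [abs_div, Nat.abs_cast, div_le_div_iff₀ hN two_pos, one_mul]
  have h1 : |y.valMinAbs * 2| ≤ N := abs_le.2 ⟨h.1.le, h.2⟩
  rw [abs_mul, abs_two] at h1
  exact_mod_cast h1

/-! ### Progressions with vanishing differences of box indicators -/

section Box
variable {N : ℕ} [NeZero N] {e R : ℕ}

/-- By linearity, every function of the box index inherits the vanishing, which leaves the test
function free to choose. -/
theorem sum_diffCoeff_mul_box (hR : 0 < R) (u : ℕ → ZMod N)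
    (h : ∀ r < R, ∑ i ∈ Finset.range (e + 1),
      (if R * (u i).val / N = r then diffCoeff e i else 0) = 0) {A : Type*} [CommRing A]
    (g : ℕ → A) :
    ∑ i ∈ Finset.range (e + 1), (diffCoeff e i : A) * g (R * (u i).val / N) = 0 := by
  have hlt : ∀ i, R * (u i).val / N < R := fun i => by
    rw [Nat.div_lt_iff_lt_mul (NeZero.pos N)]
    exact Nat.mul_lt_mul_of_pos_left (u i).val_lt hR
  have h1 : ∀ i, (diffCoeff e i : A) * g (R * (u i).val / N) = ∑ r ∈ Finset.range R,
      ((if R * (u i).val / N = r then diffCoeff e i else 0 : ℤ) : A) * g r := by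
    intro i
    rw [Finset.sum_eq_single (R * (u i).val / N)]
    · simp
    · intro r _ hr
      simp [hr.symm]
    · intro hr
      exact absurd (Finset.mem_range.2 (hlt i)) hr
  simp_rw [h1]
  rw [Finset.sum_comm]
  refine Finset.sum_eq_zero fun r hr => ?_
  rw [← Finset.sum_mul, ← Int.cast_sum, h r (Finset.mem_range.1 hr)]
  simp

/-- If the `e`-th difference of the box indicators along a progression vanishes, then the
common difference is small. -/
theorem mul_abs_valMinAbs_le (he : 0 < e) (hR : 8 * 2 ^ e * e ^ e ≤ R) (x y : ZMod N)
    (h : ∀ r < R, ∑ i ∈ Finset.range (e + 1),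
      (if R * (x + i * y).val / N = r then diffCoeff e i else 0) = 0) :
    4 * e * |y.valMinAbs| ≤ N := by
  have hN : (0 : ℝ) < N := by exact_mod_cast NeZero.pos N
  have hRpos : 0 < R := lt_of_lt_of_le (by positivity) hR
  have hRr : (0 : ℝ) < R := by exact_mod_cast hRpos
  -- The test function is the standard character rounded to boxes. The unrounded sum has modulus |1
  -- − χ(y)|^e, so this is at most the rounding error 2^e·8/R (using 2π < 8).
  have h0 := sum_diffCoeff_mul_box hRpos (fun i : ℕ => x + (i : ZMod N) * y) h
    (fun r => Complex.exp (Complex.I * (2 * Real.pi * (r / R) : ℝ)))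
  have h1 : ∑ i ∈ Finset.range (e + 1), (diffCoeff e i : ℂ) *
      ZMod.stdAddChar (x + (i : ZMod N) * y) =
      ZMod.stdAddChar x * (1 - ZMod.stdAddChar y) ^ e := by
    rw [← sum_diffCoeff_mul_pow_complex, Finset.mul_sum]
    refine Finset.sum_congr rfl fun i _ => ?_
    rw [AddChar.map_add_eq_mul, ← nsmul_eq_mul, AddChar.map_nsmul_eq_pow]
    ring
  have h2 : ∀ u : ZMod N, ‖ZMod.stdAddChar u - Complex.exp (Complex.I *
      (2 * Real.pi * ((R * u.val / N : ℕ) / R) : ℝ))‖ ≤ 8 / R := by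
    intro u
    rw [stdAddChar_eq_cexp_val]
    refine (norm_cexp_sub_cexp_le _ _).trans ?_
    rw [← mul_sub, abs_mul, abs_of_pos (by positivity)]
    have h3 : |(u.val / N : ℝ) - (R * u.val / N : ℕ) / R| ≤ 1 / R := by
      have h4 : ((R * u.val / N : ℕ) : ℝ) ≤ R * u.val / N := by exact_mod_cast Nat.cast_div_le
      have h5 : (R * u.val / N : ℝ) < (R * u.val / N : ℕ) + 1 := by
        rw [div_lt_iff₀ hN]
        have := Nat.lt_mul_div_succ (R * u.val) (NeZero.pos N)
        rw [mul_comm N] at this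
        exact_mod_cast this
      have h6 : (u.val / N : ℝ) - (R * u.val / N : ℕ) / R =
          (R * u.val / N - (R * u.val / N : ℕ)) / R := by field_simp
      rw [h6, abs_div, Nat.abs_cast]
      gcongr
      rw [abs_le]
      constructor <;> linarith
    calc _ ≤ 2 * Real.pi * (1 / R) := by gcongr
      _ ≤ 8 * (1 / R) := by
        gcongr
        linarith [Real.pi_lt_four]
      _ = 8 / R := by ring
  have h3 : ‖ZMod.stdAddChar x * (1 - ZMod.stdAddChar y) ^ e‖ ≤ 2 ^ e * (8 / R) := by
    rw [← h1, ← sub_zero (∑ i ∈ Finset.range (e + 1), _), ← h0, ← Finset.sum_sub_distrib]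
    refine (norm_sum_le _ _).trans ?_
    have hsum : (2 : ℝ) ^ e = ∑ i ∈ Finset.range (e + 1), |(diffCoeff e i : ℝ)| := by
      exact_mod_cast (sum_abs_diffCoeff e).symm
    rw [hsum, Finset.sum_mul]
    refine Finset.sum_le_sum fun i _ => ?_
    rw [← mul_sub, norm_mul, Complex.norm_intCast]
    gcongr
    exact h2 _
  rw [norm_mul, AddChar.norm_apply, one_mul, norm_pow, stdAddChar_eq_cexp_valMinAbs] at h3
  have h4 := four_mul_abs_le_norm_one_sub_cexp (abs_valMinAbs_div_le y)
  have h5 : (4 * |(y.valMinAbs / N : ℝ)|) ^ e ≤ (1 / e) ^ e := by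
    refine (pow_le_pow_left₀ (by positivity) h4 e).trans (h3.trans ?_)
    rw [one_div, inv_pow, mul_div_assoc', div_le_iff₀ hRr, inv_mul_eq_div,
      le_div_iff₀ (by positivity)]
    have : ((8 * 2 ^ e * e ^ e : ℕ) : ℝ) ≤ R := by exact_mod_cast hR
    push_cast at this
    linarith
  have h6 := le_of_pow_le_pow_left₀ he.ne' (by positivity) h5
  rw [abs_div, Nat.abs_cast, mul_div_assoc', div_le_div_iff₀ hN (by exact_mod_cast he)] at h6
  have : (4 * e * |(y.valMinAbs : ℝ)|) ≤ N := by linarith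
  exact_mod_cast this

/-- Under the hypothesis of the previous theorem the progression does not wrap around. -/
theorem val_add_mul_eq (hReven : Even R) (hRpos : 0 < R) (x y : ZMod N)
    (h : ∀ r < R, ∑ i ∈ Finset.range (e + 1),
      (if R * (x + i * y).val / N = r then diffCoeff e i else 0) = 0)
    (hy : 4 * e * |y.valMinAbs| ≤ N) {i : ℕ} (hi : i ≤ e) :
    ((x + i * y).val : ℤ) = x.val + i * y.valMinAbs := by
  obtain ⟨R', rfl⟩ := hReven
  have hN := NeZero.pos N
  set Y := y.valMinAbs with hY
  -- As R is even, the lower half of ℤ/N is a union of boxes and its indicator can be tested.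
  have h0 := sum_diffCoeff_mul_box hRpos (fun i : ℕ => x + (i : ZMod N) * y) h
    (fun r => if r < R' then (1 : ℤ) else 0)
  have hbox : ∀ u : ZMod N, (R' + R') * u.val / N < R' ↔ 2 * u.val < N := by
    intro u
    rw [Nat.div_lt_iff_lt_mul hN, ← two_mul, mul_comm 2 R', mul_assoc]
    exact Nat.mul_lt_mul_left (by omega)
  simp only [hbox, Int.cast_id, mul_ite, mul_one, mul_zero] at h0
  have hval : ∀ (i : ℕ) (c : ℤ), 0 ≤ x.val + i * Y + c * N → x.val + i * Y + c * N < N →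
      ((x + i * y).val : ℤ) = x.val + i * Y + c * N := by
    intro i c h1 h2
    have h3 : ((x.val + i * Y + c * N : ℤ) : ZMod N) = x + i * y := by
      push_cast
      rw [hY, ZMod.coe_valMinAbs]
      simp
    rw [← h3, ZMod.val_intCast, Int.emod_eq_of_lt h1 h2]
  have hx := x.val_lt
  have hstep : ∀ i j : ℕ, i ≤ j → j ≤ e → 4 * |j * Y - i * Y| ≤ N := by
    intro i j hij hj
    refine le_trans ?_ hy
    rw [← sub_mul, abs_mul, mul_assoc]
    refine mul_le_mul_of_nonneg_left (mul_le_mul_of_nonneg_right ?_ (abs_nonneg _)) (by norm_num)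
    rw [abs_of_nonneg (by linarith [Int.ofNat_le.2 hij])]
    linarith [Int.ofNat_le.2 hj, Int.natCast_nonneg i]
  by_cases hgood : ∀ i ≤ e, 0 ≤ x.val + i * Y ∧ x.val + i * Y < N
  · have := hval i 0 (by simpa using (hgood i hi).1) (by simpa using (hgood i hi).2)
    simpa using this
  exfalso
  push Not at hgood
  obtain ⟨j, hje, hj⟩ := hgood
  rcases le_or_gt 0 Y with hY0 | hY0
  · have hj' : (N : ℤ) ≤ x.val + j * Y := hj (by positivity)
    have hex : ∃ t : ℕ, (N : ℤ) ≤ x.val + t * Y := ⟨j, hj'⟩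
    classical
    obtain ⟨t, ht, htmin⟩ : ∃ t : ℕ, (N : ℤ) ≤ x.val + t * Y ∧ ∀ i < t, x.val + i * Y < N :=
      ⟨Nat.find hex, Nat.find_spec hex, fun i hi => not_le.1 (Nat.find_min hex hi)⟩
    have htj : t ≤ j := by
      by_contra hlt
      exact absurd (htmin j (not_le.1 hlt)) (not_lt.2 hj')
    have ht0 : 0 < t := by
      rcases Nat.eq_zero_or_pos t with rfl | h
      · rw [Nat.cast_zero, zero_mul] at ht; omega
      · exact h
    -- The total displacement is at most N/4. If index t is the first to pass N, earlier terms lie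
    -- in the top quarter and later ones in the bottom quarter, so the lower-half indicator is
    -- exactly that of i ≥ t. The case of negative step is the mirror image.
    apply sum_diffCoeff_ge_ne_zero (e := e) ht0 (htj.trans hje)
    refine Eq.trans (Finset.sum_congr rfl fun i hi => ?_) h0
    have hi' : i ≤ e := Nat.lt_succ_iff.1 (Finset.mem_range.1 hi)
    by_cases hit : t ≤ i
    · have h1 := (abs_le.1 (show |(i : ℤ) * Y - (0 : ℕ) * Y| ≤ N / 4 by
        have := hstep 0 i (Nat.zero_le _) hi'; omega)).2
      have h2 : (t : ℤ) * Y ≤ i * Y := mul_le_mul_of_nonneg_right (by exact_mod_cast hit) hY0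
      have h3 := hval i (-1) (by linarith) (by push_cast at h1; omega)
      rw [if_pos hit, if_pos]
      push_cast at h1
      omega
    · have hit' := not_le.1 hit
      have h1 := (abs_le.1 (show |(t : ℤ) * Y - i * Y| ≤ N / 4 by
        have := hstep i t hit'.le (htj.trans hje); omega)).2
      have h2 : (0 : ℤ) ≤ i * Y := by positivity
      have h3 := hval i 0 (by linarith) (by linarith [htmin i hit'])
      rw [if_neg hit, if_neg (show ¬ 2 * (x + i * y).val < N by omega)]
  · have hj' : x.val + j * Y < 0 := by
      by_contra hcon
      have := hj (not_lt.1 hcon)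
      have : (j : ℤ) * Y ≤ 0 := mul_nonpos_of_nonneg_of_nonpos (by positivity) hY0.le
      omega
    have hex : ∃ t : ℕ, x.val + t * Y < 0 := ⟨j, hj'⟩
    classical
    obtain ⟨t, ht, htmin⟩ : ∃ t : ℕ, x.val + t * Y < 0 ∧ ∀ i < t, 0 ≤ x.val + i * Y :=
      ⟨Nat.find hex, Nat.find_spec hex, fun i hi => not_lt.1 (Nat.find_min hex hi)⟩
    have htj : t ≤ j := by
      by_contra hlt
      exact absurd (htmin j (not_le.1 hlt)) (not_le.2 hj')
    have ht0 : 0 < t := by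
      rcases Nat.eq_zero_or_pos t with rfl | h
      · rw [Nat.cast_zero, zero_mul] at ht; omega
      · exact h
    apply sum_diffCoeff_lt_ne_zero (e := e) ht0 (htj.trans hje)
    refine Eq.trans (Finset.sum_congr rfl fun i hi => ?_) h0
    have hi' : i ≤ e := Nat.lt_succ_iff.1 (Finset.mem_range.1 hi)
    by_cases hit : i < t
    · have h1 := (abs_le.1 (show |(t : ℤ) * Y - i * Y| ≤ N / 4 by
        have := hstep i t hit.le (htj.trans hje); omega)).1
      have h2 : (i : ℤ) * Y ≤ 0 := mul_nonpos_of_nonneg_of_nonpos (by positivity) hY0.le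
      have h3 := hval i 0 (by linarith [htmin i hit]) (by omega)
      rw [if_pos hit, if_pos]
      omega
    · have hit' := not_lt.1 hit
      have h1 := (abs_le.1 (show |(i : ℤ) * Y - (0 : ℕ) * Y| ≤ N / 4 by
        have := hstep 0 i (Nat.zero_le _) hi'; omega)).1
      have h2 : (i : ℤ) * Y ≤ t * Y := mul_le_mul_of_nonpos_right (by exact_mod_cast hit') hY0.le
      push_cast at h1
      have h3 := hval i 1 (by omega) (by linarith)
      rw [if_neg hit, if_neg (show ¬ 2 * (x + i * y).val < N by omega)]

/-- The `e`-th difference of the `e`-th power of a rounded real progression. -/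
theorem le_sum_diffCoeff_mul_div_pow (he : Even e) {Q : ℕ} (x y : ZMod N)
    (h : ∀ i ≤ e, ((x + i * y).val : ℤ) = x.val + i * y.valMinAbs) :
    (e.factorial : ℝ) * (Q * (y.valMinAbs / N)) ^ e - 2 ^ e * (e * Q ^ (e - 1)) ≤
      ∑ i ∈ Finset.range (e + 1), (diffCoeff e i : ℝ) * ((Q * (x + i * y).val / N : ℕ) : ℝ) ^ e := by
  have hN : (0 : ℝ) < N := by exact_mod_cast NeZero.pos N
  rw [← sum_diffCoeff_mul_pow_self he (Q * (x.val / N))]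
  have hsum : (2 : ℝ) ^ e = ∑ i ∈ Finset.range (e + 1), |(diffCoeff e i : ℝ)| := by
    exact_mod_cast (sum_abs_diffCoeff e).symm
  rw [hsum, Finset.sum_mul, sub_le_iff_le_add, ← Finset.sum_add_distrib]
  refine Finset.sum_le_sum fun i hi => ?_
  have hi' : i ≤ e := Nat.lt_succ_iff.1 (Finset.mem_range.1 hi)
  have hw : (Q * (x.val / N) + i * (Q * (y.valMinAbs / N)) : ℝ) = Q * (x + i * y).val / N := by
    have : ((x + i * y).val : ℝ) = x.val + i * y.valMinAbs := by exact_mod_cast h i hi'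
    rw [this]
    ring
  rw [hw]
  set v := (x + i * y).val with hv
  have hvN : (v : ℝ) ≤ N := by exact_mod_cast (ZMod.val_lt _).le
  have h4 : ((Q * v / N : ℕ) : ℝ) ≤ Q * v / N := by exact_mod_cast Nat.cast_div_le
  have h5 : (Q * v / N : ℝ) < (Q * v / N : ℕ) + 1 := by
    rw [div_lt_iff₀ hN]
    have := Nat.lt_mul_div_succ (Q * v) (NeZero.pos N)
    rw [mul_comm N] at this
    exact_mod_cast this
  have h6 : (Q * v / N : ℝ) ≤ Q := by
    rw [div_le_iff₀ hN]
    gcongr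
  have h7 : |(Q * v / N : ℝ) ^ e - ((Q * v / N : ℕ) : ℝ) ^ e| ≤ e * Q ^ (e - 1) := by
    refine (abs_pow_sub_pow_le _ _ _).trans ?_
    rw [abs_of_nonneg (show (0 : ℝ) ≤ Q * v / N by positivity), Nat.abs_cast, max_eq_left h4]
    calc _ ≤ 1 * (e : ℝ) * Q ^ (e - 1) := by
          gcongr
          rw [abs_le]
          constructor <;> linarith
      _ = _ := by ring
  have h8 : (diffCoeff e i : ℝ) * ((Q * v / N : ℝ) ^ e - ((Q * v / N : ℕ) : ℝ) ^ e) ≤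
      |(diffCoeff e i : ℝ)| * (e * Q ^ (e - 1)) := by
    refine (le_abs_self _).trans ?_
    rw [abs_mul]
    gcongr
  linarith

end Box

/-! ### Packing all constraints into one integer -/

/-- Reduction modulo B kills the lowest signed digit, and one divides by B. The last digit W is
unrestricted in size, which leaves room for the power sum in `digitCode`. -/
theorem eq_zero_of_sum_pow_mul_eq_zero {B : ℤ} : ∀ (T : ℕ) (w : ℕ → ℤ) (W : ℤ),
    (∀ t < T, |w t| < B) → ∑ t ∈ Finset.range T, B ^ t * w t + B ^ T * W = 0 →
      (∀ t < T, w t = 0) ∧ W = 0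
  | 0, w, W, _, h => ⟨fun t ht => absurd ht (Nat.not_lt_zero t), by simpa using h⟩
  | T + 1, w, W, hw, h => by
    have hB : 0 < B := (abs_nonneg _).trans_lt (hw 0 (Nat.succ_pos T))
    rw [Finset.sum_range_succ'] at h
    have h1 : B * (∑ t ∈ Finset.range T, B ^ t * w (t + 1) + B ^ T * W) = -w 0 := by
      rw [mul_add, Finset.mul_sum]
      have : ∑ t ∈ Finset.range T, B * (B ^ t * w (t + 1)) =
          ∑ t ∈ Finset.range T, B ^ (t + 1) * w (t + 1) :=
        Finset.sum_congr rfl fun t _ => by ring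
      rw [this]
      linear_combination h
    have h0 : w 0 = 0 :=
      Int.eq_zero_of_abs_lt_dvd ((dvd_neg).1 ⟨_, h1.symm⟩) (hw 0 (Nat.succ_pos T))
    rw [h0, neg_zero, mul_eq_zero] at h1
    obtain ⟨h2, h3⟩ := eq_zero_of_sum_pow_mul_eq_zero T (fun t => w (t + 1)) W
      (fun t ht => hw _ (Nat.succ_lt_succ ht)) (h1.resolve_left hB.ne')
    refine ⟨fun t ht => ?_, h3⟩
    rcases t with _ | t
    · exact h0
    · exact h2 t (Nat.succ_lt_succ_iff.1 ht)

/-- The `l`-th digit of `j` in a base `q` expansion with overlapping blocks of size `Q`. -/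
def blockDigit (Q q D j l : ℕ) : ℕ := j / q ^ (D - l) % Q

/-- The index of n among the Q·q^D finest intervals determines, for every l ≤ D, the position of
q^l·n among Q intervals: a single partition sees all dilates at once. -/
theorem blockDigit_eq {N : ℕ} [NeZero N] {Q q D l : ℕ} (hQ : 0 < Q) (hq : 0 < q) (hl : l ≤ D)
    (n : ZMod N) :
    blockDigit Q q D (Q * q ^ D * n.val / N) l = Q * ((q : ZMod N) ^ l * n).val / N := by
  have hN := NeZero.pos N
  have hqpos : 0 < q ^ (D - l) := pow_pos hq _
  have h1 : Q * q ^ D * n.val / N / q ^ (D - l) = Q * (q ^ l * n.val) / N := by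
    rw [Nat.div_div_eq_div_mul, mul_comm N]
    have : Q * q ^ D * n.val = q ^ (D - l) * (Q * (q ^ l * n.val)) := by
      conv_lhs => rw [← Nat.sub_add_cancel hl, pow_add]
      ring
    rw [this, Nat.mul_div_mul_left _ _ hqpos]
  have h2 : ((q : ZMod N) ^ l * n).val = (q ^ l * n.val) % N := by
    rw [← ZMod.val_natCast]
    congr 1
    simp
  rw [blockDigit, h1, h2]
  set a := q ^ l * n.val
  have h3 : Q * a = N * (Q * (a / N)) + Q * (a % N) := by
    conv_lhs => rw [← Nat.div_add_mod a N]
    ring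
  rw [h3, Nat.mul_add_div hN, Nat.mul_add_mod, Nat.mod_eq_of_lt]
  rw [Nat.div_lt_iff_lt_mul hN]
  exact Nat.mul_lt_mul_of_pos_left (Nat.mod_lt _ hN) hQ

/-- An integer which encodes the leading part of every digit, and the sum of the `e`-th powers of
the digits. -/
def digitCode (e R Q q D j : ℕ) : ℕ :=
  ∑ t ∈ Finset.range (R * D),
      (2 ^ e + 1) ^ t * (if blockDigit (R * Q) q D j (t / R) / Q = t % R then 1 else 0) +
    (2 ^ e + 1) ^ (R * D) * ∑ l ∈ Finset.range D, blockDigit (R * Q) q D j l ^ e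

theorem digitCode_le (e q D j : ℕ) {R Q : ℕ} (hR : 0 < R) (hQ : 0 < Q) :
    digitCode e R Q q D j ≤ (2 ^ e + 1) ^ (R * D) * (1 + D * (R * Q) ^ e) := by
  have h1 : ∀ T : ℕ, ∑ t ∈ Finset.range T, (2 ^ e + 1) ^ t ≤ (2 ^ e + 1) ^ T := by
    intro T
    induction T with
    | zero => simp
    | succ T ih =>
      rw [Finset.sum_range_succ, pow_succ]
      have := Nat.mul_le_mul_left ((2 ^ e + 1) ^ T)
        (show 2 ≤ 2 ^ e + 1 from Nat.succ_le_succ Nat.one_le_two_pow)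
      linarith
  rw [digitCode, mul_add, mul_one]
  refine add_le_add ((Finset.sum_le_sum fun t _ => ?_).trans (h1 _)) (Nat.mul_le_mul_left _ ?_)
  · split_ifs <;> simp
  · calc _ ≤ ∑ _l ∈ Finset.range D, (R * Q) ^ e := Finset.sum_le_sum fun l _ =>
          Nat.pow_le_pow_left (Nat.mod_lt _ (Nat.mul_pos hR hQ)).le e
      _ = _ := by simp

section Rigid
variable {N : ℕ} [NeZero N] {e R Q q D : ℕ}

/-- If the `e`-th difference of `digitCode` vanishes along a progression, then so do those of
its components. -/
theorem sum_diffCoeff_digitCode_decode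
    (hR : 0 < R) (j : ℕ → ℕ)
    (h : ∑ i ∈ Finset.range (e + 1), diffCoeff e i * (digitCode e R Q q D (j i) : ℤ) = 0) :
    (∀ l < D, ∀ r < R, ∑ i ∈ Finset.range (e + 1),
      (if blockDigit (R * Q) q D (j i) l / Q = r then diffCoeff e i else 0) = 0) ∧
    ∑ l ∈ Finset.range D, ∑ i ∈ Finset.range (e + 1),
      diffCoeff e i * (blockDigit (R * Q) q D (j i) l : ℤ) ^ e = 0 := by
  set w : ℕ → ℤ := fun t => ∑ i ∈ Finset.range (e + 1),
    (if blockDigit (R * Q) q D (j i) (t / R) / Q = t % R then diffCoeff e i else 0) with hw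
  set W : ℤ := ∑ l ∈ Finset.range D, ∑ i ∈ Finset.range (e + 1),
      diffCoeff e i * (blockDigit (R * Q) q D (j i) l : ℤ) ^ e with hW
  have hexp : ∑ t ∈ Finset.range (R * D), ((2 : ℤ) ^ e + 1) ^ t * w t +
      ((2 : ℤ) ^ e + 1) ^ (R * D) * W = 0 := by
    rw [← h, hw, hW]
    simp only [digitCode, Nat.cast_add, Nat.cast_mul, Nat.cast_sum, mul_add, Finset.sum_add_distrib,
      Finset.mul_sum, Nat.cast_pow, Nat.cast_one, Nat.cast_ofNat, Nat.cast_ite, Nat.cast_zero]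
    congr 1
    · rw [Finset.sum_comm]
      refine Finset.sum_congr rfl fun i _ => Finset.sum_congr rfl fun t _ => ?_
      split_ifs <;> ring
    · rw [Finset.sum_comm]
      refine Finset.sum_congr rfl fun i _ => Finset.sum_congr rfl fun t _ => ?_
      ring
  -- The base 2^e + 1 is chosen because the e-th difference of a 0/1 sequence is at most 2^e in
  -- absolute value.
  have hwlt : ∀ t < R * D, |w t| < (2 : ℤ) ^ e + 1 := by
    intro t _
    rw [Int.lt_add_one_iff, ← sum_abs_diffCoeff]
    refine (Finset.abs_sum_le_sum_abs _ _).trans (Finset.sum_le_sum fun i _ => ?_)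
    split_ifs <;> simp
  obtain ⟨h1, h2⟩ := eq_zero_of_sum_pow_mul_eq_zero _ w W hwlt hexp
  refine ⟨fun l hl r hr => ?_, h2⟩
  have h3 := h1 (R * l + r) (by nlinarith)
  simp only [hw] at h3
  rwa [Nat.mul_add_div hR, Nat.div_eq_of_lt hr, add_zero, Nat.mul_add_mod,
    Nat.mod_eq_of_lt hr] at h3

/-- Evenness of e makes all main terms nonnegative, so each is bounded by the total rounding error
D·2^e·e·S^(e−1). The main term has one more factor S, and S beats the constants. -/
theorem mul_abs_lt_of_sum_pow_le {N : ℕ} (hN : 0 < N) (heven : Even e) (he : 0 < e) {S : ℕ}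
    (hS : D * 2 ^ e * e * (q + 1) ^ e < S) (Y : ℕ → ℤ)
    (h : ∑ l ∈ Finset.range D, ((e.factorial : ℝ) * (S * (Y l / N)) ^ e -
      2 ^ e * (e * S ^ (e - 1))) ≤ 0) {l : ℕ} (hl : l < D) : (q + 1) * |Y l| < N := by
  have hN' : (0 : ℝ) < N := by exact_mod_cast hN
  have hS0 : (0 : ℝ) < S := by exact_mod_cast (Nat.zero_le _).trans_lt hS
  rw [Finset.sum_sub_distrib, Finset.sum_const, Finset.card_range, nsmul_eq_mul, sub_nonpos] at h
  have h1 : (S * (Y l / N) : ℝ) ^ e ≤ ∑ l ∈ Finset.range D,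
      (e.factorial : ℝ) * (S * (Y l / N)) ^ e := by
    refine le_trans ?_ (Finset.single_le_sum (f := fun l => (e.factorial : ℝ) * (S * (Y l / N)) ^ e)
      (fun l _ => mul_nonneg (Nat.cast_nonneg _) (heven.pow_nonneg _)) (Finset.mem_range.2 hl))
    exact le_mul_of_one_le_left (heven.pow_nonneg _)
      (by exact_mod_cast Nat.one_le_iff_ne_zero.2 e.factorial_ne_zero)
  by_contra hcon
  rw [not_lt] at hcon
  have h2 : (1 / (q + 1) : ℝ) ^ e ≤ (Y l / N) ^ e := by
    rw [← heven.pow_abs (Y l / N : ℝ)]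
    refine pow_le_pow_left₀ (by positivity) ?_ e
    rw [abs_div, Nat.abs_cast, div_le_div_iff₀ (by positivity) hN', one_mul, mul_comm]
    exact_mod_cast hcon
  have h3 : (S : ℝ) ^ (e - 1) * (S * (1 / (q + 1)) ^ e) ≤
      S ^ (e - 1) * (D * 2 ^ e * e) := by
    calc (S : ℝ) ^ (e - 1) * (S * (1 / (q + 1)) ^ e) = S ^ e * (1 / (q + 1)) ^ e := by
          rw [← mul_assoc, ← pow_succ, Nat.sub_add_cancel he]
      _ ≤ S ^ e * (Y l / N) ^ e := by gcongr
      _ = (S * (Y l / N)) ^ e := by rw [mul_pow]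
      _ ≤ _ := h1.trans h
      _ = _ := by ring
  have h4 := le_of_mul_le_mul_left h3 (by positivity)
  rw [div_pow, one_pow, mul_one_div, div_le_iff₀ (by positivity)] at h4
  have : (S : ℝ) ≤ ((D * 2 ^ e * e * (q + 1) ^ e : ℕ) : ℝ) := by
    push_cast
    exact h4
  exact absurd (by exact_mod_cast this) (not_le.2 hS)

/-- A progression along which the `e`-th difference of `digitCode` vanishes has a small common
difference. -/
theorem pow_mul_abs_valMinAbs_le (heven : Even e) (he : 0 < e) (hReven : Even R)
    (hR : 8 * 2 ^ e * e ^ e ≤ R) (hq : 0 < q) (hD : 0 < D)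
    (hQ : D * 2 ^ e * e * (q + 1) ^ e ≤ Q) (n d : ZMod N)
    (h : ∑ i ∈ Finset.range (e + 1), diffCoeff e i *
      (digitCode e R Q q D (R * Q * q ^ D * (n + i * d).val / N) : ℤ) = 0) :
    q ^ D * |d.valMinAbs| ≤ N := by
  have hN := NeZero.pos N
  have hRpos : 0 < R := lt_of_lt_of_le (by positivity) hR
  have hQpos : 0 < Q := lt_of_lt_of_le (by positivity) hQ
  have hS : D * 2 ^ e * e * (q + 1) ^ e < R * Q := by
    obtain ⟨R', rfl⟩ := hReven
    have := Nat.mul_le_mul_right Q (show 2 ≤ R' + R' by omega)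
    linarith
  obtain ⟨h1, h2⟩ := sum_diffCoeff_digitCode_decode hRpos
    (fun i => R * Q * q ^ D * (n + i * d).val / N) h
  have hdig : ∀ l ≤ D, ∀ i : ℕ, blockDigit (R * Q) q D (R * Q * q ^ D * (n + i * d).val / N) l =
      R * Q * ((q : ZMod N) ^ l * n + i * ((q : ZMod N) ^ l * d)).val / N := by
    intro l hl i
    rw [blockDigit_eq (Nat.mul_pos hRpos hQpos) hq hl]
    congr 4
    ring
  set Y : ℕ → ℤ := fun l => ((q : ZMod N) ^ l * d).valMinAbs with hY
  have hwrap : ∀ l < D, ∀ i ≤ e, ((((q : ZMod N) ^ l * n + i * ((q : ZMod N) ^ l * d)).val : ℕ) : ℤ) =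
      ((q : ZMod N) ^ l * n).val + i * Y l := by
    intro l hl i hi
    have h3 : ∀ r < R, ∑ i ∈ Finset.range (e + 1), (if R * ((q : ZMod N) ^ l * n +
        i * ((q : ZMod N) ^ l * d)).val / N = r then diffCoeff e i else 0) = 0 := by
      intro r hr
      refine Eq.trans (Finset.sum_congr rfl fun i _ => ?_) (h1 l hl r hr)
      rw [hdig l hl.le i, Nat.div_div_eq_div_mul, mul_right_comm R Q, Nat.mul_div_mul_right _ _ hQpos]
    exact val_add_mul_eq hReven hRpos _ _ h3 (mul_abs_valMinAbs_le he hR _ _ h3) hi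
  have hsum : ∑ l ∈ Finset.range D, ((e.factorial : ℝ) * ((R * Q : ℕ) * (Y l / N)) ^ e -
      2 ^ e * (e * ((R * Q : ℕ) : ℝ) ^ (e - 1))) ≤ 0 := by
    have h2' : ∑ l ∈ Finset.range D, ∑ i ∈ Finset.range (e + 1), (diffCoeff e i : ℝ) *
        (blockDigit (R * Q) q D (R * Q * q ^ D * (n + i * d).val / N) l : ℝ) ^ e = 0 := by
      exact_mod_cast h2
    rw [← h2']
    refine Finset.sum_le_sum fun l hl => ?_
    have hl' := Finset.mem_range.1 hl
    simp_rw [hdig l hl'.le]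
    exact le_sum_diffCoeff_mul_div_pow heven _ _ (hwrap l hl')
  have hlt : ∀ l < D, (q + 1) * |Y l| < N := fun l hl =>
    mul_abs_lt_of_sum_pow_le hN heven he hS Y hsum hl
  -- Y(l+1) ≡ q·Y(l) modulo N, and both satisfy (q+1)|Y| < N, so the two sides differ by less than N
  -- and the congruence is an equality.
  have hrec : ∀ l, l < D → Y l = q ^ l * Y 0 := by
    intro l
    induction l with
    | zero => simp
    | succ l ih =>
      intro hl
      have h4 := hlt l (by omega)
      have h5 := hlt (l + 1) hl
      have h6 : (N : ℤ) ∣ Y (l + 1) - q * Y l := by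
        rw [← ZMod.intCast_zmod_eq_zero_iff_dvd]
        push_cast
        simp only [hY, ZMod.coe_valMinAbs]
        ring
      have h7 : |Y (l + 1) - q * Y l| < N := by
        refine (abs_sub _ _).trans_lt ?_
        rw [abs_mul, Nat.abs_cast]
        have hq' : (0 : ℤ) < q := by exact_mod_cast hq
        nlinarith
      have h8 := Int.eq_zero_of_abs_lt_dvd h6 h7
      rw [sub_eq_zero.1 h8, ih (by omega)]
      ring
  have h9 := hlt (D - 1) (by omega)
  rw [hrec (D - 1) (by omega), abs_mul, abs_pow, Nat.abs_cast] at h9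
  have h10 : Y 0 = d.valMinAbs := by simp [hY]
  rw [h10] at h9
  have h11 : (q : ℤ) ^ D = q * q ^ (D - 1) := by
    rw [← pow_succ', Nat.sub_add_cancel hD]
  rw [h11]
  nlinarith [abs_nonneg d.valMinAbs, show (0 : ℤ) ≤ q ^ (D - 1) * |d.valMinAbs| by positivity]

end Rigid

/-! ### From arcs to an exact integer relation -/

/-- The e-th difference kills the power e − 1, so the difference of the real lifts is an integer z =
E + S, where S comes from the arc origins and E from the offsets within arcs. The factor 4 in the
denominator gives |S| ≤ 1/4, hence z = 0. Then T·S is an integer of size below 1. -/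
theorem eq_zero_of_mem_circleArc {N : ℕ} [NeZero N] {e : ℕ} (heven : Even e) (he : 0 < e)
    {G : ℕ} (hG : 0 < G) {α : ℝ} (hα : 2 ^ e * (4 * 2 ^ e * G) * α < 1) (n d : ZMod N)
    (Γ : ℕ → ℕ) (hΓ : ∀ i, Γ i ≤ G)
    (h : ∀ i ≤ e, ZMod.toAddCircle ((n + (i : ZMod N) * d) ^ (e - 1)) ∈
      circleArc (Γ i / (4 * 2 ^ e * G)) α) :
    ∑ i ∈ Finset.range (e + 1), diffCoeff e i * (Γ i : ℤ) = 0 := by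
  choose! v hv hveq using h
  set T : ℝ := 4 * 2 ^ e * G with hT
  have hG' : (1 : ℝ) ≤ G := by exact_mod_cast hG
  have hK : (1 : ℝ) ≤ 2 ^ e := one_le_pow₀ (by norm_num)
  have hT4 : 4 ≤ T := by rw [hT]; nlinarith
  have hT0 : 0 < T := by linarith
  have hi' : ∀ i ∈ Finset.range (e + 1), i ≤ e := fun i hi =>
    Nat.lt_succ_iff.1 (Finset.mem_range.1 hi)
  have hsum : (2 : ℝ) ^ e = ∑ i ∈ Finset.range (e + 1), |(diffCoeff e i : ℝ)| := by
    exact_mod_cast (sum_abs_diffCoeff e).symm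
  have h0 : ((∑ i ∈ Finset.range (e + 1), (diffCoeff e i : ℝ) * v i : ℝ) : UnitAddCircle) = 0 := by
    have h1 : ∑ i ∈ Finset.range (e + 1), diffCoeff e i •
        (ZMod.toAddCircle ((n + (i : ZMod N) * d) ^ (e - 1)) : UnitAddCircle) = 0 := by
      have h2 := congrArg (ZMod.toAddCircle (N := N))
        (sum_diffCoeff_mul_pow_eq_zero heven (Nat.sub_lt he one_pos) n d)
      rw [map_sum, map_zero] at h2
      rw [← h2]
      refine Finset.sum_congr rfl fun i _ => ?_
      rw [← zsmul_eq_mul, map_zsmul]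
    rw [← h1, ← QuotientAddGroup.mk'_apply, map_sum]
    refine Finset.sum_congr rfl fun i hi => ?_
    rw [← hveq i (hi' i hi), ← zsmul_eq_mul, map_zsmul]
    rfl
  obtain ⟨z, hz⟩ := (AddCircle.coe_eq_zero_iff 1).1 h0
  rw [zsmul_one] at hz
  set E : ℝ := ∑ i ∈ Finset.range (e + 1), (diffCoeff e i : ℝ) * (v i - Γ i / T) with hE
  set S : ℝ := ∑ i ∈ Finset.range (e + 1), (diffCoeff e i : ℝ) * (Γ i / T) with hS
  have hES : (z : ℝ) = E + S := by
    rw [hz, hE, hS, ← Finset.sum_add_distrib]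
    exact Finset.sum_congr rfl fun i _ => by ring
  have hEle : |E| ≤ 2 ^ e * α := by
    rw [hsum, Finset.sum_mul]
    refine (Finset.abs_sum_le_sum_abs _ _).trans (Finset.sum_le_sum fun i hi => ?_)
    rw [abs_mul]
    have := hv i (hi' i hi)
    rw [Set.mem_Ico] at this
    refine mul_le_mul_of_nonneg_left ?_ (abs_nonneg _)
    rw [abs_le]
    constructor <;> linarith
  have hSle : |S| ≤ 1 / 4 := by
    have : |S| ≤ 2 ^ e * (G / T) := by
      rw [hsum, Finset.sum_mul]
      refine (Finset.abs_sum_le_sum_abs _ _).trans (Finset.sum_le_sum fun i _ => ?_)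
      rw [abs_mul, abs_of_nonneg (show (0 : ℝ) ≤ Γ i / T by positivity)]
      gcongr
      exact_mod_cast hΓ i
    refine this.trans (le_of_eq ?_)
    rw [hT]
    field_simp
  have hαT : 2 ^ e * α < 1 / T := by
    rw [lt_div_iff₀ hT0]
    linarith
  have hE4 : 1 / T ≤ 1 / 4 := one_div_le_one_div_of_le (by norm_num) hT4
  have hz0 : z = 0 := by
    have h3 : |(z : ℝ)| < 1 := by
      rw [hES]
      refine (abs_add_le _ _).trans_lt ?_
      linarith
    exact Int.abs_lt_one_iff.1 (by exact_mod_cast h3)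
  have hSE : S = -E := by
    rw [hz0, Int.cast_zero] at hES
    linarith
  have hTS : T * S = ((∑ i ∈ Finset.range (e + 1), diffCoeff e i * (Γ i : ℤ) : ℤ) : ℝ) := by
    rw [hS, Finset.mul_sum]
    push_cast
    refine Finset.sum_congr rfl fun i _ => ?_
    field_simp
  refine Int.abs_lt_one_iff.1 ?_
  have h5 : |T * S| < 1 := by
    rw [abs_mul, abs_of_pos hT0, hSE, abs_neg]
    rw [lt_div_iff₀ hT0] at hαT
    nlinarith
  rw [hTS] at h5
  exact_mod_cast h5

/-! ### Counting progressions by their common difference -/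

section Density
variable {N : ℕ} [NeZero N]

theorem indicator_one_mem_Icc {X : Type*} (A : Set X) (x : X) :
    0 ≤ A.indicator (1 : X → ℝ) x ∧ A.indicator (1 : X → ℝ) x ≤ 1 := by
  by_cases hx : x ∈ A <;> simp [hx]

theorem apDensity_nonneg (k : ℕ) (A : Set (ZMod N)) : 0 ≤ apDensity k A :=
  Finset.expect_nonneg fun _ _ => Finset.prod_nonneg fun _ _ => (indicator_one_mem_Icc A _).1

theorem expect_indicator_eq (A : Set (ZMod N)) :
    𝔼 x, A.indicator (1 : ZMod N → ℝ) x = (A.ncard : ℝ) / N := by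
  classical
  rw [Fintype.expect_eq_sum_div_card, ZMod.card, Set.ncard_eq_toFinset_card']
  congr 1
  simp only [Set.indicator_apply, Pi.one_apply, Finset.sum_boole, Set.filter_mem_univ_eq_toFinset]

theorem apDensity_le_ncard_div {k : ℕ} (hk : 0 < k) (A : Set (ZMod N)) :
    apDensity k A ≤ (A.ncard : ℝ) / N := by
  rw [← expect_indicator_eq, apDensity, apForm, ← Finset.univ_product_univ, Finset.expect_product]
  refine Finset.expect_le_expect fun n _ => Finset.expect_le Finset.univ_nonempty fun d _ => ?_
  obtain ⟨k, rfl⟩ := Nat.exists_eq_add_of_lt hk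
  rw [zero_add, Finset.prod_range_succ']
  simp only [zero_smul, add_zero]
  exact mul_le_of_le_one_left (indicator_one_mem_Icc A n).1
    (Finset.prod_le_one (fun _ _ => (indicator_one_mem_Icc A _).1)
      fun _ _ => (indicator_one_mem_Icc A _).2)

theorem card_filter_mul_abs_valMinAbs_le (m : ℕ) (hm : 0 < m) :
    (Finset.univ.filter fun d : ZMod N => m * |d.valMinAbs| ≤ N).card ≤ 2 * (N / m) + 1 := by
  have h : (Finset.univ.filter fun d : ZMod N => m * |d.valMinAbs| ≤ N).card ≤
      (Finset.Icc (-((N / m : ℕ) : ℤ)) ((N / m : ℕ) : ℤ)).card := by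
    refine Finset.card_le_card_of_injOn ZMod.valMinAbs (fun d hd => ?_)
      (ZMod.injective_valMinAbs.injOn)
    rw [Finset.mem_coe, Finset.mem_filter] at hd
    rw [Finset.coe_Icc, Set.mem_Icc, ← abs_le, Int.natCast_div,
      Int.le_ediv_iff_mul_le (by exact_mod_cast hm)]
    linarith [hd.2]
  refine h.trans ?_
  rw [Int.card_Icc]
  omega

theorem apDensity_le_of_forall {k m : ℕ} (hm : 0 < m) (hmN : m ≤ N) (A : Set (ZMod N))
    (h : ∀ n d : ZMod N, (∀ i < k, n + i * d ∈ A) → m * |d.valMinAbs| ≤ N) :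
    apDensity k A ≤ 3 / m := by
  classical
  have hN : (0 : ℝ) < N := by exact_mod_cast NeZero.pos N
  have hm' : (0 : ℝ) < m := by exact_mod_cast hm
  rw [apDensity, apForm, ← Finset.univ_product_univ, Finset.expect_product]
  have h1 : ∀ n d : ZMod N, ∏ i ∈ Finset.range k, A.indicator (1 : ZMod N → ℝ) (n + i • d) ≤
      if m * |d.valMinAbs| ≤ N then 1 else 0 := by
    intro n d
    split_ifs with hd
    · exact Finset.prod_le_one (fun _ _ => (indicator_one_mem_Icc A _).1)
        fun _ _ => (indicator_one_mem_Icc A _).2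
    · obtain ⟨i, hi, hiA⟩ : ∃ i < k, n + (i : ZMod N) * d ∉ A := by
        by_contra! hcon
        exact hd (h n d hcon)
      rw [Finset.prod_eq_zero (Finset.mem_range.2 hi)]
      rw [nsmul_eq_mul]
      exact Set.indicator_of_notMem hiA _
  refine Finset.expect_le Finset.univ_nonempty fun n _ =>
    (Finset.expect_le_expect fun d _ => h1 n d).trans ?_
  rw [Fintype.expect_eq_sum_div_card, ZMod.card, Finset.sum_boole, div_le_div_iff₀ hN hm']
  have h2 := card_filter_mul_abs_valMinAbs_le (N := N) m hm
  have h3 : (Finset.univ.filter fun d : ZMod N => m * |d.valMinAbs| ≤ N).card * m ≤ 3 * N := by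
    -- The constant 3 is 2 from both signs of d plus 1 for the extra term, since m ≤ N.
    have := Nat.div_mul_le_self N m
    nlinarith
  exact_mod_cast h3

end Density

/-! ### Choice of parameters -/

/-- Functions of a natural number which grow at most exponentially. -/
def ExpBounded (f : ℕ → ℕ) : Prop := ∃ C : ℕ, ∀ D, 0 < D → f D ≤ 2 ^ (C * D)

theorem ExpBounded.const (a : ℕ) : ExpBounded fun _ => a :=
  ⟨a, fun _ hD => Nat.lt_two_pow_self.le.trans
    (Nat.pow_le_pow_right two_pos (Nat.le_mul_of_pos_right a hD))⟩

theorem ExpBounded.id : ExpBounded fun D => D :=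
  ⟨1, fun D _ => by rw [one_mul]; exact Nat.lt_two_pow_self.le⟩

theorem ExpBounded.const_pow (a b : ℕ) : ExpBounded fun D => a ^ (b * D) :=
  ⟨a * b, fun D _ => by
    rw [mul_assoc, pow_mul]
    exact Nat.pow_le_pow_left Nat.lt_two_pow_self.le _⟩

theorem ExpBounded.mul {f g : ℕ → ℕ} (hf : ExpBounded f) (hg : ExpBounded g) :
    ExpBounded fun D => f D * g D := by
  obtain ⟨C, hC⟩ := hf
  obtain ⟨C', hC'⟩ := hg
  exact ⟨C + C', fun D hD => by
    rw [add_mul, pow_add]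
    exact Nat.mul_le_mul (hC D hD) (hC' D hD)⟩

theorem ExpBounded.pow {f : ℕ → ℕ} (hf : ExpBounded f) (a : ℕ) :
    ExpBounded fun D => f D ^ a := by
  obtain ⟨C, hC⟩ := hf
  exact ⟨C * a, fun D hD => by
    rw [mul_right_comm, pow_mul]
    exact Nat.pow_le_pow_left (hC D hD) a⟩

theorem ExpBounded.one_add {f : ℕ → ℕ} (hf : ExpBounded f) : ExpBounded fun D => 1 + f D := by
  obtain ⟨C, hC⟩ := hf
  refine ⟨C + 1, fun D hD => ?_⟩
  have h1 : 1 ≤ 2 ^ (C * D) := Nat.one_le_two_pow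
  have h2 : 2 ≤ 2 ^ D := Nat.le_self_pow hD.ne' 2
  rw [add_mul, one_mul, pow_add]
  nlinarith [hC D hD]

/-- For densities `α ≤ 2 ^ (-C D)` there are phase sets of density `α` in which every progression
has a common difference in a set of density about `2 ^ (-D ^ 2)`. -/
theorem exists_phaseSet_apDensity_le {e : ℕ} (heven : Even e) (he : 0 < e) :
    ∃ C : ℕ, 0 < C ∧ ∀ D : ℕ, 0 < D → ∀ α : ℝ, 0 < α → α * 2 ^ (C * D) ≤ 1 →
      ∃ (M : ℕ) (γ : ℕ → ℝ), 0 < M ∧ ∀ (N : ℕ) [NeZero N], 2 ^ (D * D) ≤ N →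
        apDensity (e + 1) (phaseSet (e - 1) M γ α N) ≤ 3 / 2 ^ (D * D) := by
  set R : ℕ := 8 * 2 ^ e * e ^ e with hR
  set Q : ℕ → ℕ := fun D => D * 2 ^ e * e * (2 ^ D + 1) ^ e with hQ
  set G : ℕ → ℕ := fun D => (2 ^ e + 1) ^ (R * D) * (1 + D * (R * Q D) ^ e) with hG
  have hReven : Even R := by
    rw [hR, mul_assoc]
    exact (show Even 8 by decide).mul_right _
  have hRpos : 0 < R := by positivity
  have hQb : ExpBounded Q := by
    refine ((ExpBounded.id.mul (.const _)).mul (.const _)).mul (ExpBounded.pow ?_ e)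
    have := (ExpBounded.const_pow 2 1).one_add
    simpa only [one_mul, add_comm 1] using this
  have hb : ExpBounded fun D => 2 ^ e * (4 * 2 ^ e * G D) :=
    (ExpBounded.const _).mul ((ExpBounded.const _).mul ((ExpBounded.const_pow _ _).mul
      (ExpBounded.id.mul (((ExpBounded.const R).mul hQb).pow e)).one_add))
  obtain ⟨C, hC⟩ := hb
  -- The extra factor 2^D makes the required inequality strict.
  refine ⟨C + 1, Nat.succ_pos C, fun D hD α hα hαC => ?_⟩
  have hQpos : 0 < Q D := by positivity
  have hGpos : 0 < G D := by positivity
  -- The base is q = 2^D: it enters the size of the code only through a fixed power of q, still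
  -- 2^(O(D)), while q^D = 2^(D²) is gained.
  refine ⟨R * Q D * (2 ^ D) ^ D,
    fun j => (digitCode e R (Q D) (2 ^ D) D j : ℝ) / (4 * 2 ^ e * G D), by positivity,
    fun N _ hN => ?_⟩
  have hα1 : 2 ^ e * (4 * 2 ^ e * (G D : ℝ)) * α < 1 := by
    have h1 : (2 ^ e * (4 * 2 ^ e * (G D : ℝ))) ≤ 2 ^ (C * D) := by exact_mod_cast hC D hD
    have h2 : (2 : ℝ) ^ (C * D) < 2 ^ ((C + 1) * D) :=
      pow_lt_pow_right₀ (by norm_num) (by nlinarith)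
    calc _ ≤ 2 ^ (C * D) * α := by gcongr
      _ < 2 ^ ((C + 1) * D) * α := by gcongr
      _ ≤ 1 := by linarith
  have h3 := apDensity_le_of_forall (N := N) (k := e + 1) (m := 2 ^ (D * D)) (by positivity) hN
    (phaseSet (e - 1) (R * Q D * (2 ^ D) ^ D)
      (fun j => (digitCode e R (Q D) (2 ^ D) D j : ℝ) / (4 * 2 ^ e * G D)) α N) ?_
  · simpa using h3
  · intro n d hnd
    have h4 := eq_zero_of_mem_circleArc heven he hGpos hα1 n d
      (fun i => digitCode e R (Q D) (2 ^ D) D (R * Q D * (2 ^ D) ^ D * (n + i * d).val / N))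
      (fun i => digitCode_le e (2 ^ D) D _ hRpos hQpos)
      (fun i hi => hnd i (Nat.lt_succ_of_le hi))
    have h5 := pow_mul_abs_valMinAbs_le heven he hReven le_rfl (by positivity) hD le_rfl n d h4
    rw [pow_mul]
    exact_mod_cast h5

/-! ### From uniform families to ρ and to sequences of sets -/

section Sequences
variable {s : ℕ} {α : ℝ} {A : (N : ℕ) → [NeZero N] → Set (ZMod N)}

theorem tendsto_ncard_div_of_isBoxSmall
    (hA : IsBoxSmall (s + 1) fun N _ n => (A N).indicator 1 n - (α : ℂ)) {ε : ℝ} (hε : 0 < ε) :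
    ∃ N₀ : ℕ, ∀ (N : ℕ) [NeZero N], N₀ ≤ N → |((A N).ncard : ℝ) / N - α| ≤ ε := by
  obtain ⟨N₀, h₀⟩ := hA.expect hε
  refine ⟨N₀, fun N _ hN => ?_⟩
  have h1 := h₀ N hN
  have h2 : 𝔼 x : ZMod N, ((A N).indicator 1 x - (α : ℂ)) =
      ((((A N).ncard : ℝ) / N - α : ℝ) : ℂ) := by
    rw [← expect_indicator_eq, Finset.expect_sub_distrib, Fintype.expect_const,
      Complex.ofReal_sub, Complex.ofReal_expect]
    congr 1
    refine Finset.expect_congr rfl fun x _ => ?_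
    by_cases hx : x ∈ A N <;> simp [hx]
  rwa [h2, Complex.norm_real] at h1

theorem gowersDist_le_of_isBoxSmall {a : (N : ℕ) → [NeZero N] → ℝ}
    (ha : ∀ (N : ℕ) [NeZero N], 0 ≤ a N ∧ a N ≤ 1)
    (hA : IsBoxSmall s fun N _ n => (A N).indicator 1 n - (a N : ℂ)) {ε : ℝ} (hε : 0 < ε) :
    ∃ N₀ : ℕ, ∀ (N : ℕ) [NeZero N], N₀ ≤ N → gowersDist s (A N) (a N) ≤ ε := by
  obtain ⟨N₀, h₀⟩ := hA (ε ^ 2 ^ s) (by positivity)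
  refine ⟨N₀, fun N _ hN => ?_⟩
  have hreal : ∀ x, (A N).indicator (1 : ZMod N → ℂ) x - (a N : ℂ) =
      (((A N).indicator (1 : ZMod N → ℝ) x - a N : ℝ) : ℂ) := by
    intro x
    by_cases hx : x ∈ A N <;> simp [hx]
  refine gowersNorm_le_of_isBoxTest (fun x => ?_) (fun x => ?_) s hε.le (h₀ N hN)
  · rw [hreal, Complex.norm_real, Real.norm_eq_abs, abs_le]
    have := indicator_one_mem_Icc (A N) x
    have := ha N
    constructor <;> linarith
  · rw [hreal, Complex.conj_ofReal]

theorem isBoxSmall_sub_density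
    (hA : IsBoxSmall (s + 1) fun N _ n => (A N).indicator 1 n - (α : ℂ)) :
    IsBoxSmall (s + 1) fun N _ n =>
      (A N).indicator 1 n - ((((A N).ncard : ℝ) / N : ℝ) : ℂ) := by
  refine IsBoxSmall.of_approx fun ε hε => ⟨_, hA, ?_⟩
  obtain ⟨N₀, h₀⟩ := tendsto_ncard_div_of_isBoxSmall hA hε
  refine ⟨N₀, fun N _ hN => Finset.expect_le Finset.univ_nonempty fun x _ => ?_⟩
  have := h₀ N hN
  rw [sub_sub_sub_cancel_left, ← Complex.ofReal_sub, Complex.norm_real, Real.norm_eq_abs, abs_sub_comm]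
  exact this

theorem ncard_div_mem_Icc {N : ℕ} [NeZero N] (A : Set (ZMod N)) :
    0 ≤ (A.ncard : ℝ) / N ∧ (A.ncard : ℝ) / N ≤ 1 := by
  rw [← expect_indicator_eq]
  exact ⟨Finset.expect_nonneg fun x _ => (indicator_one_mem_Icc A x).1,
    Finset.expect_le Finset.univ_nonempty fun x _ => (indicator_one_mem_Icc A x).2⟩

/-- The admissible lower bounds contain 0 and are at most β, as the family A itself shows. The
supremum is attained because the definition allows a loss ε, which can be split in two. -/
theorem isGreatest_rho_of_isBoxSmall {k : ℕ} (hα : 0 ≤ α ∧ α ≤ 1)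
    (hA : IsBoxSmall (k - 2) fun N _ n => (A N).indicator 1 n - (α : ℂ)) {β : ℝ} {N₁ : ℕ}
    (hβ : ∀ (N : ℕ) [NeZero N], N₁ ≤ N → apDensity k (A N) ≤ β) :
    IsGreatest (apLowerBounds k α) (rho k α) ∧ rho k α ≤ β := by
  have hub : ∀ r ∈ apLowerBounds k α, r ≤ β := by
    intro r hr
    refine le_of_forall_pos_le_add fun ε hε => ?_
    obtain ⟨η, hη, N₀, h₀⟩ := hr ε hε
    obtain ⟨N₂, h₂⟩ := gowersDist_le_of_isBoxSmall (a := fun _ _ => α) (fun _ _ => hα) hA hη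
    set N := max (max N₀ N₁) (max N₂ 1) with hN
    have : NeZero N := ⟨by omega⟩
    have h3 := h₀ N (by omega) (A N) (h₂ N (by omega))
    have h4 := hβ N (by omega)
    linarith
  have hne : (apLowerBounds k α).Nonempty := ⟨0, fun ε hε => ⟨1, one_pos, 0, fun N _ _ A' _ => by
    linarith [apDensity_nonneg k A']⟩⟩
  have hbdd : BddAbove (apLowerBounds k α) := ⟨β, hub⟩
  refine ⟨⟨fun ε hε => ?_, fun r hr => le_csSup hbdd hr⟩, csSup_le hne hub⟩
  obtain ⟨r, hr, hlt⟩ := exists_lt_of_lt_csSup hne (show rho k α - ε / 2 < sSup _ by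
    rw [rho]; linarith)
  obtain ⟨η, hη, N₀, h₀⟩ := hr (ε / 2) (by positivity)
  exact ⟨η, hη, N₀, fun N _ hN A' hA' => by linarith [h₀ N hN A' hA']⟩

open Classical in
/-- Discarding the first few terms of a uniform sequence of sets. -/
theorem exists_gowersUniform_of_isBoxSmall {k : ℕ} (hk : 0 < k)
    (hA : IsBoxSmall (s + 1) fun N _ n => (A N).indicator 1 n - (α : ℂ)) {β : ℝ} (hβ0 : 0 ≤ β)
    {N₁ : ℕ} (hβ : ∀ (N : ℕ) [NeZero N], N₁ ≤ N → apDensity k (A N) ≤ β) :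
    ∃ A' : (N : ℕ) → Set (ZMod N), IsGowersUniform (s + 1) A' ∧
      Tendsto (fun N : ℕ => ((A' N).ncard : ℝ) / N) atTop (𝓝 α) ∧
      ∀ (N : ℕ) [NeZero N], apDensity k (A' N) ≤ β := by
  set A' : (N : ℕ) → Set (ZMod N) := fun N =>
    if h : 0 < N ∧ N₁ ≤ N then @A N ⟨h.1.ne'⟩ else ∅ with hA'
  have heq : ∀ (N : ℕ) [NeZero N], N₁ ≤ N → A' N = A N := by
    intro N _ hN
    simp only [hA']
    rw [dif_pos ⟨NeZero.pos N, hN⟩]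
  refine ⟨A', fun ε hε => ?_, ?_, fun N _ => ?_⟩
  · obtain ⟨N₀, h₀⟩ := gowersDist_le_of_isBoxSmall (fun N _ => ncard_div_mem_Icc (A N))
      (isBoxSmall_sub_density hA) hε
    refine ⟨max N₀ N₁, fun N _ hN => ?_⟩
    rw [heq N (le_of_max_le_right hN)]
    exact h₀ N (le_of_max_le_left hN)
  · rw [Metric.tendsto_atTop]
    intro ε hε
    obtain ⟨N₀, h₀⟩ := tendsto_ncard_div_of_isBoxSmall hA (half_pos hε)
    refine ⟨max (max N₀ N₁) 1, fun N hN => ?_⟩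
    have : NeZero N := ⟨by omega⟩
    rw [heq N (by omega), Real.dist_eq]
    exact (h₀ N (by omega)).trans_lt (by linarith)
  · by_cases hN : N₁ ≤ N
    · rw [heq N hN]
      exact hβ N hN
    -- The discarded terms are empty, so the bound holds for every N rather than only eventually.
    · have : A' N = ∅ := by
        simp only [hA']
        rw [dif_neg (by tauto)]
      rw [this]
      refine (apDensity_le_ncard_div hk _).trans ?_
      simpa using hβ0

end Sequences

/-! ### Numerical constants and conclusion -/

/-- Here l is log(1/α). Since l ≤ 2C·D·log 2, the constant 32 makes the exponent at most (log
2)·D²/8, far below the available (log 2)(D² − 2). -/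
theorem three_div_two_pow_sq_lt {C D : ℕ} (hD : 4 ≤ D) {l : ℝ} (hl : 0 ≤ l)
    (h : l < C * Real.log 2 * (D + 1)) :
    3 / 2 ^ (D * D) < Real.exp (-(1 / (32 * C ^ 2) * l ^ 2)) := by
  have hC : (0 : ℝ) < C := by
    by_contra hcon
    have : (C : ℝ) = 0 := le_antisymm (not_lt.1 hcon) (Nat.cast_nonneg C)
    rw [this] at h
    linarith
  have hD' : (4 : ℝ) ≤ D := by exact_mod_cast hD
  have hlog0 : 0 < Real.log 2 := Real.log_pos one_lt_two
  have hlog1 : Real.log 2 < 1 := by linarith [Real.log_two_lt_d9]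
  have h1 : l ≤ 2 * C * Real.log 2 * D := by
    have : C * Real.log 2 * ((D : ℝ) + 1) ≤ C * Real.log 2 * (2 * D) := by
      gcongr
      linarith
    linarith
  have h2 : 1 / (32 * (C : ℝ) ^ 2) * l ^ 2 ≤ Real.log 2 * (D ^ 2 / 8) := by
    calc 1 / (32 * (C : ℝ) ^ 2) * l ^ 2 ≤
          1 / (32 * (C : ℝ) ^ 2) * (2 * C * Real.log 2 * D) ^ 2 := by gcongr
      _ = Real.log 2 * (Real.log 2 * D ^ 2 / 8) := by
        field_simp
        ring
      _ ≤ Real.log 2 * (1 * D ^ 2 / 8) := by gcongr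
      _ = _ := by ring
  have h3 : (3 : ℝ) / 2 ^ (D * D) < Real.exp (Real.log 2 * (2 - D ^ 2)) := by
    have : Real.exp (Real.log 2 * (2 - (D : ℝ) ^ 2)) = 4 / 2 ^ (D * D) := by
      rw [← Real.rpow_def_of_pos two_pos, Real.rpow_sub two_pos, ← pow_two D, ← Nat.cast_pow,
        Real.rpow_natCast]
      norm_num
    rw [this]
    gcongr
    norm_num
  refine h3.trans_le (Real.exp_le_exp.2 ?_)
  nlinarith

theorem half_lt_exp {C : ℕ} (hC : 0 < C) {l : ℝ} (hl : 0 ≤ l) (h : l < C * Real.log 2 * 4) :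
    1 / 2 < Real.exp (-(1 / (32 * C ^ 2) * l ^ 2)) := by
  have hC' : (0 : ℝ) < C := by exact_mod_cast hC
  have hlog0 : 0 < Real.log 2 := Real.log_pos one_lt_two
  have hlog1 : Real.log 2 < 1 := by linarith [Real.log_two_lt_d9]
  have h2 : 1 / (32 * (C : ℝ) ^ 2) * l ^ 2 < Real.log 2 := by
    calc 1 / (32 * (C : ℝ) ^ 2) * l ^ 2 ≤
          1 / (32 * (C : ℝ) ^ 2) * (C * Real.log 2 * 4) ^ 2 := by gcongr
      _ = Real.log 2 * (Real.log 2 / 2) := by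
        field_simp
        ring
      _ < Real.log 2 := by nlinarith
  rw [one_div, ← Real.exp_log (show (0 : ℝ) < 2⁻¹ by norm_num), Real.log_inv]
  exact Real.exp_lt_exp.2 (by linarith)

/-- Uniform families of sets of density `α` with few arithmetic progressions. -/
theorem exists_isBoxSmall_apDensity_le {s : ℕ} (hs : Odd s) (hs2 : 2 ≤ s) :
    ∃ c : ℝ, 0 < c ∧ ∀ α : ℝ, 0 < α → α < 1 / 2 →
      ∃ (A : (N : ℕ) → [NeZero N] → Set (ZMod N)) (β : ℝ) (N₁ : ℕ),
        IsBoxSmall s (fun N _ n => (A N).indicator 1 n - (α : ℂ)) ∧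
        β < α ^ (c * Real.log (1 / α)) ∧
        ∀ (N : ℕ) [NeZero N], N₁ ≤ N → apDensity (s + 2) (A N) ≤ β := by
  obtain ⟨C, hC, hCD⟩ := exists_phaseSet_apDensity_le (e := s + 1) hs.add_one (Nat.succ_pos s)
  obtain ⟨s, rfl⟩ := Nat.exists_eq_add_of_le' hs2
  refine ⟨1 / (32 * C ^ 2), by positivity, fun α hα0 hα1 => ?_⟩
  set l := Real.log (1 / α) with hl
  have hl0 : 0 ≤ l := Real.log_nonneg (by rw [le_div_iff₀ hα0]; linarith)
  have hα : α = Real.exp (-l) := by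
    rw [hl, one_div, Real.log_inv, neg_neg, Real.exp_log hα0]
  have hpow : α ^ (1 / (32 * (C : ℝ) ^ 2) * l) = Real.exp (-(1 / (32 * C ^ 2) * l ^ 2)) := by
    rw [Real.rpow_def_of_pos hα0, show Real.log α = -l by rw [hα, Real.log_exp]]
    congr 1
    ring
  rw [hpow]
  have hlog0 : 0 < Real.log 2 := Real.log_pos one_lt_two
  have hCl : 0 < C * Real.log 2 := by positivity
  rcases lt_or_ge l (C * Real.log 2 * 4) with hlt | hge
  -- For α bounded below, the target exceeds 1/2, so one fixed arc suffices: the progression density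
  -- is at most the density of the set, eventually at most 1/2.
  · have hsmall := isBoxSmall_phaseSet s one_pos (fun _ => 0) hα0.le (by linarith)
    obtain ⟨N₁, h₁⟩ := tendsto_ncard_div_of_isBoxSmall hsmall (show 0 < 1 / 2 - α by linarith)
    refine ⟨_, 1 / 2, N₁, hsmall, half_lt_exp hC hl0 hlt, fun N _ hN => ?_⟩
    refine (apDensity_le_ncard_div (Nat.succ_pos _) _).trans ?_
    linarith [le_of_abs_le (h₁ N hN)]
  -- The largest D for which α·2^(CD) ≤ 1.
  · set D := ⌊l / (C * Real.log 2)⌋₊ with hD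
    have hD4 : 4 ≤ D := Nat.le_floor (by rw [le_div_iff₀ hCl]; push_cast; linarith)
    have hDle : D * (C * Real.log 2) ≤ l := by
      rw [← le_div_iff₀ hCl]
      exact Nat.floor_le (by positivity)
    have hDlt : l < C * Real.log 2 * (D + 1) := by
      rw [mul_comm, ← div_lt_iff₀ hCl]
      exact Nat.lt_floor_add_one _
    have hαC : α * 2 ^ (C * D) ≤ 1 := by
      have h2 : (2 : ℝ) ^ (C * D) = Real.exp (D * (C * Real.log 2)) := by
        rw [← Real.rpow_natCast, Real.rpow_def_of_pos two_pos]
        congr 1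
        push_cast
        ring
      rw [h2, hα, ← Real.exp_add, ← Real.exp_zero]
      exact Real.exp_le_exp.2 (by linarith)
    obtain ⟨M, γ, hM, h⟩ := hCD D (by omega) α hα0 hαC
    exact ⟨_, _, 2 ^ (D * D), isBoxSmall_phaseSet s hM γ hα0.le (by linarith),
      three_div_two_pow_sq_lt hD4 hl0 hDlt, fun N _ hN => h N hN⟩

theorem mainTheorem1 (k : ℕ) (hk : 5 ≤ k) (hodd : Odd k) :
    ∃ c : ℝ, 0 < c ∧ ∀ α : ℝ, 0 < α → α < 1 / 2 →
      (IsGreatest (apLowerBounds k α) (rho k α) ∧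
        rho k α < α ^ (c * Real.log (1 / α))) ∧
      ∃ A : (N : ℕ) → Set (ZMod N),
        IsGowersUniform (k - 2) A ∧
        Tendsto (fun N : ℕ => ((A N).ncard : ℝ) / N) atTop (𝓝 α) ∧
        ∀ (N : ℕ) [NeZero N], apDensity k (A N) ≤ α ^ (c * Real.log (1 / α)) := by
  obtain ⟨s, rfl⟩ := Nat.exists_eq_add_of_le' (show 3 ≤ k by omega)
  have hs : Odd (s + 1) := by
    rw [Nat.odd_iff] at hodd ⊢
    omega
  obtain ⟨c, hc, h⟩ := exists_isBoxSmall_apDensity_le hs (by omega)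
  refine ⟨c, hc, fun α hα0 hα1 => ?_⟩
  obtain ⟨A, β, N₁, hA, hβ, hAβ⟩ := h α hα0 hα1
  obtain ⟨hgreat, hle⟩ := isGreatest_rho_of_isBoxSmall (k := s + 3) ⟨hα0.le, by linarith⟩ hA hAβ
  exact ⟨⟨hgreat, hle.trans_lt hβ⟩, exists_gowersUniform_of_isBoxSmall (Nat.succ_pos _) hA
    (by positivity) fun N _ hN => (hAβ N hN).trans hβ.le⟩
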